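/- Let $\mathbb{X}=(X,\rho,\mu)$ be a metric measure space, i.e. a metric space $(X,\rho)$ with a Borel measure $\mu$ for which every open ball $B(x,r)=\{y:\rho(x,y)<r\}$, $r>0$, satisfies $0<\mu(B(x,r))<\infty$. The centered and non-centered Hardy–Littlewood maximal operators are $$M^cf(x)=\sup_{r>0}\frac1{\mu(B(x,r))}\int_{B(x,r)}|f|\,d\mu,\qquad Mf(x)=\sup_{B\ni x}\frac1{\mu(B)}\int_B|f|\,d\mu,$$ where $B$ runs over all open balls containing $x$. For $p\in[1,\infty]$, an operator $T$ is of strong type $(p,p)$ if there is a constant $C<\infty$ with $\|Tf\|_p\le C\|f\|_p$ for all $f\in L^p(\mu)$, and of weak type $(p,p)$ if there is $C<\infty$ with $\|Tf\|_{p,\infty}\le C\|f\|_p$ for all $f\in L^p(\mu)$, where $\|g\|_{p,\infty}=\sup_{\lambda>0}\lambda\,\mu(\{|g|>\lambda\})^{1/p}$ for $p<\infty$ and $\|g\|_{\infty,\infty}=\|g\|_\infty$. The measure $\mu$ is doubling if there is $C<\infty$ with $\mu(B(x,2r))\le C\mu(B(x,r))$ for all $x\in X$, $r>0$. **Theorem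 1.** Let $P_s^c,P_s,P_w^c,P_w\subset[1,\infty]$ be four sets such that (i) each of them is of the form $\{\infty\}$, $[p_0,\infty]$ or $(p_0,\infty]$ for some $p_0\in[1,\infty)$ (which may be different for different sets); (ii) $P_s\subset P_s^c$, $P_w\subset P_w^c$, $P_s^c\subset P_w^c\subset\overline{P_s^c}$ and $P_s\subset P_w\subset\overline{P_s}$, where $\overline{E}$ is the closure of $E$ in the usual topology of $[1,\infty]$. Then there exists a metric measure space, with $\mu$ not doubling, such that for every $p\in[1,\infty]$: - $M^c$ is of strong type $(p,p)$ if and only if $p\in P_s^c$; - $M$ is of strong type $(p,p)$ if and only if $p\in P_s$; - $M^c$ is of weak type $(p,p)$ if and only if $p\in P_w^c$; - $M$ is of weak type $(p,p)$ if and only if $p\in P_w$. -/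

import Mathlib

open MeasureTheory Set
open scoped ENNReal NNReal

noncomputable section

/-- The standing assumption on the measure of a metric measure space:
every ball (of positive radius) has strictly positive and finite measure. -/
def BallsPosFinite {X : Type*} [MetricSpace X] [MeasurableSpace X] (μ : Measure X) : Prop :=
  ∀ (x : X) (r : ℝ), 0 < r → 0 < μ (Metric.ball x r) ∧ μ (Metric.ball x r) < ∞

/-- The (global) doubling condition `μ (B(x, 2r)) ≤ C μ (B(x, r))`, with `C` independent of
`x` and `r`. -/
def IsDoublingMeasure {X : Type*} [MetricSpace X] [MeasurableSpace X] (μ : Measure X) : Prop :=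
  ∃ C : ℝ≥0, ∀ (x : X) (r : ℝ), 0 < r →
    μ (Metric.ball x (2 * r)) ≤ C * μ (Metric.ball x r)

/-- The average of `|f|` over the open ball `B(z, r)`. -/
def ballAverage {X : Type*} [MetricSpace X] [MeasurableSpace X] (μ : Measure X)
    (f : X → ℝ) (z : X) (r : ℝ) : ℝ≥0∞ :=
  (∫⁻ y in Metric.ball z r, ‖f y‖ₑ ∂μ) / μ (Metric.ball z r)

/-- The centered Hardy–Littlewood maximal operator `M^c`. -/
def centeredMaximal {X : Type*} [MetricSpace X] [MeasurableSpace X] (μ : Measure X)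
    (f : X → ℝ) (x : X) : ℝ≥0∞ :=
  ⨆ (r : ℝ) (_ : 0 < r), ballAverage μ f x r

/-- The non-centered Hardy–Littlewood maximal operator `M`: the supremum is taken over all open
balls containing `x` (whose radii are then automatically positive). -/
def noncenteredMaximal {X : Type*} [MetricSpace X] [MeasurableSpace X] (μ : Measure X)
    (f : X → ℝ) (x : X) : ℝ≥0∞ :=
  ⨆ (z : X) (r : ℝ) (_ : x ∈ Metric.ball z r), ballAverage μ f z r

/-- The quasi-norm of `L^{p,∞}`, namely `sup_{t > 0} t μ {g > t}^{1/p}` for finite `p`, with the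
convention `L^{∞,∞} = L^∞`. -/
def weakLpNorm {X : Type*} [MeasurableSpace X] (g : X → ℝ≥0∞) (p : ℝ≥0∞) (μ : Measure X) :
    ℝ≥0∞ :=
  if p = ∞ then eLpNorm g ∞ μ
  else ⨆ (t : ℝ≥0) (_ : 0 < t), (t : ℝ≥0∞) * μ {x | (t : ℝ≥0∞) < g x} ^ (1 / p.toReal)

/-- `T` is of strong type `(p,p)`: it is bounded on `L^p`. -/
def HasStrongType {X : Type*} [MeasurableSpace X] (T : (X → ℝ) → X → ℝ≥0∞) (p : ℝ≥0∞)
    (μ : Measure X) : Prop :=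
  ∃ C : ℝ≥0, ∀ f : X → ℝ, MemLp f p μ → eLpNorm (T f) p μ ≤ C * eLpNorm f p μ

/-- `T` is of weak type `(p,p)`: it is bounded from `L^p` to `L^{p,∞}`. -/
def HasWeakType {X : Type*} [MeasurableSpace X] (T : (X → ℝ) → X → ℝ≥0∞) (p : ℝ≥0∞)
    (μ : Measure X) : Prop :=
  ∃ C : ℝ≥0, ∀ f : X → ℝ, MemLp f p μ → weakLpNorm (T f) p μ ≤ C * eLpNorm f p μ

/-- `P` is of the form `{∞}`, `[p₀, ∞]` or `(p₀, ∞]` with `p₀ ∈ [1, ∞)`. -/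
def IsExponentSet (P : Set ℝ≥0∞) : Prop :=
  P = {∞} ∨ ∃ p₀ : ℝ≥0∞, 1 ≤ p₀ ∧ p₀ < ∞ ∧ (P = Icc p₀ ∞ ∨ P = Ioc p₀ ∞)

end

/-! The space is a countable union of finite stars with subdivided edges (hub, mids, tips).
Distances are 0, 1, 2, so a ball is a point, a closed neighborhood of a vertex, or everything.
Averages over points, over the whole finite-measure space, and over neighborhoods of hubs and tips
are harmless: together they define an operator bounded on L¹ with a uniform constant
(`lintegral_tameMaximal_le`), and Jensen's inequality transfers this to every finite `p`.

Only the triples {hub, mid, tip} matter. The average over such a triple is at most a harmless tip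
average plus `|f(hub)| / (1 + a + b)`. A centered ball shows the last term only at the mid, a
non-centered one also at the tip. Testing on indicators of hubs gives the converse, so strong or
weak type (p,p) means exactly that the function `decay` has uniformly bounded L^p or weak L^p norm
on the normalized stars (`IsControlled.hasStrongType_iff`, `IsControlled.hasWeakType_iff`).

With tips of mass `2 ^ j`, the triple has height about `2⁻ʲ`. There are two families of stars. In
the first, mid and tip have equal mass, so both operators see mass comparable to `2 ^ j` at that
height. In the second, the mids have total mass at most one, so the centered operator sees nothing
and the non-centered one sees the tips. The number of leaves at each level then prescribes the
exponents: the first family realizes the two sets for the centered operator, the second those for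
the non-centered one (`exists_isProfile`). The non-centered operator must be bounded on both
families, which gives intersections; the assumed inclusions reduce these to the desired sets. -/

/-! ### Jensen's inequality, integral forms of the types, the endpoint `p = ∞`. -/

theorem lintegral_div_measure_univ_le {X : Type*} [MeasurableSpace X] (τ : Measure X)
    {F : X → ℝ≥0∞} (hF : AEMeasurable F τ) (h0 : τ univ ≠ 0) (ht : τ univ ≠ ∞)
    {q : ℝ} (hq : 1 ≤ q) :
    (∫⁻ x, F x ∂τ) / τ univ ≤ ((∫⁻ x, F x ^ q ∂τ) / τ univ) ^ (1 / q) := by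
  have hq0 : 0 < q := by linarith
  have : IsProbabilityMeasure ((τ univ)⁻¹ • τ) := ⟨by
    simp [ENNReal.inv_mul_cancel h0 ht]⟩
  have h := eLpNorm'_le_eLpNorm'_of_exponent_le zero_lt_one hq ((τ univ)⁻¹ • τ)
    ((hF.smul_measure (τ univ)⁻¹).aestronglyMeasurable)
  simpa [eLpNorm', div_eq_mul_inv, mul_comm] using h

theorem hasStrongType_iff {X : Type*} [MeasurableSpace X] {T : (X → ℝ) → X → ℝ≥0∞}
    {p : ℝ≥0∞} {μ : Measure X} (hp : 1 ≤ p) (hp' : p ≠ ∞) :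
    HasStrongType T p μ ↔ ∃ C : ℝ≥0, ∀ f : X → ℝ, MemLp f p μ →
      ∫⁻ x, T f x ^ p.toReal ∂μ ≤ C * ∫⁻ x, ‖f x‖ₑ ^ p.toReal ∂μ := by
  have hp0 : p ≠ 0 := (zero_lt_one.trans_le hp).ne'
  have hq : 0 < p.toReal := ENNReal.toReal_pos hp0 hp'
  have key : ∀ (C : ℝ≥0) (f : X → ℝ), eLpNorm (T f) p μ ≤ C * eLpNorm f p μ ↔
      ∫⁻ x, T f x ^ p.toReal ∂μ ≤ ((C ^ p.toReal : ℝ≥0) : ℝ≥0∞) * ∫⁻ x, ‖f x‖ₑ ^ p.toReal ∂μ := by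
    intro C f
    rw [eLpNorm_eq_lintegral_rpow_enorm_toReal hp0 hp', eLpNorm_eq_lintegral_rpow_enorm_toReal hp0 hp',
      ← ENNReal.rpow_le_rpow_iff hq, ENNReal.mul_rpow_of_nonneg _ _ hq.le, ← ENNReal.rpow_mul,
      ← ENNReal.rpow_mul, one_div_mul_cancel hq.ne', ENNReal.rpow_one, ENNReal.rpow_one,
      ENNReal.coe_rpow_of_nonneg _ hq.le]
    rfl
  constructor
  · rintro ⟨C, hC⟩
    exact ⟨C ^ p.toReal, fun f hf => (key C f).1 (hC f hf)⟩
  · rintro ⟨C, hC⟩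
    refine ⟨C ^ (1 / p.toReal), fun f hf => (key _ f).2 ?_⟩
    rw [← NNReal.rpow_mul, one_div_mul_cancel hq.ne', NNReal.rpow_one]
    exact hC f hf

theorem hasWeakType_iff {X : Type*} [MeasurableSpace X] {T : (X → ℝ) → X → ℝ≥0∞}
    {p : ℝ≥0∞} {μ : Measure X} (hp : 1 ≤ p) (hp' : p ≠ ∞) :
    HasWeakType T p μ ↔ ∃ C : ℝ≥0, ∀ f : X → ℝ, MemLp f p μ → ∀ t : ℝ≥0, 0 < t →
      (t : ℝ≥0∞) ^ p.toReal * μ {x | (t : ℝ≥0∞) < T f x} ≤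
        C * ∫⁻ x, ‖f x‖ₑ ^ p.toReal ∂μ := by
  have hp0 : p ≠ 0 := (zero_lt_one.trans_le hp).ne'
  have hq : 0 < p.toReal := ENNReal.toReal_pos hp0 hp'
  have key : ∀ (C : ℝ≥0) (f : X → ℝ), weakLpNorm (T f) p μ ≤ C * eLpNorm f p μ ↔
      ∀ t : ℝ≥0, 0 < t → (t : ℝ≥0∞) ^ p.toReal * μ {x | (t : ℝ≥0∞) < T f x} ≤
        ((C ^ p.toReal : ℝ≥0) : ℝ≥0∞) * ∫⁻ x, ‖f x‖ₑ ^ p.toReal ∂μ := by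
    intro C f
    rw [weakLpNorm, if_neg hp', iSup₂_le_iff]
    refine forall₂_congr fun t _ => ?_
    rw [eLpNorm_eq_lintegral_rpow_enorm_toReal hp0 hp',
      ← ENNReal.rpow_le_rpow_iff hq, ENNReal.mul_rpow_of_nonneg _ _ hq.le,
      ENNReal.mul_rpow_of_nonneg _ _ hq.le, ← ENNReal.rpow_mul,
      ← ENNReal.rpow_mul, one_div_mul_cancel hq.ne', ENNReal.rpow_one, ENNReal.rpow_one,
      ENNReal.coe_rpow_of_nonneg _ hq.le]
  constructor
  · rintro ⟨C, hC⟩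
    exact ⟨C ^ p.toReal, fun f hf => (key C f).1 (hC f hf)⟩
  · rintro ⟨C, hC⟩
    refine ⟨C ^ (1 / p.toReal), fun f hf => (key _ f).2 ?_⟩
    rw [← NNReal.rpow_mul, one_div_mul_cancel hq.ne', NNReal.rpow_one]
    exact hC f hf

theorem ballAverage_le_eLpNorm_top {X : Type*} [MetricSpace X] [MeasurableSpace X]
    (μ : Measure X) (f : X → ℝ) (z : X) (r : ℝ) :
    ballAverage μ f z r ≤ eLpNorm f ∞ μ := by
  refine ENNReal.div_le_of_le_mul ?_
  calc ∫⁻ y in Metric.ball z r, ‖f y‖ₑ ∂μ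
      ≤ ∫⁻ y in Metric.ball z r, eLpNorm f ∞ μ ∂μ :=
        lintegral_mono_ae (ae_restrict_of_ae (by
          rw [eLpNorm_exponent_top]; exact enorm_ae_le_eLpNormEssSup f μ))
    _ = _ := by simp

theorem centeredMaximal_le_noncenteredMaximal {X : Type*} [MetricSpace X] [MeasurableSpace X]
    (μ : Measure X) (f : X → ℝ) (x : X) :
    centeredMaximal μ f x ≤ noncenteredMaximal μ f x :=
  iSup₂_le fun r hr => le_iSup_of_le x <| le_iSup₂_of_le r (Metric.mem_ball_self hr) le_rfl

theorem noncenteredMaximal_le_eLpNorm_top {X : Type*} [MetricSpace X] [MeasurableSpace X]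
    (μ : Measure X) (f : X → ℝ) (x : X) : noncenteredMaximal μ f x ≤ eLpNorm f ∞ μ :=
  iSup_le fun z => iSup₂_le fun r _ => ballAverage_le_eLpNorm_top μ f z r

theorem hasStrongType_top {X : Type*} [MeasurableSpace X] {T : (X → ℝ) → X → ℝ≥0∞}
    {μ : Measure X} (h : ∀ f x, T f x ≤ eLpNorm f ∞ μ) : HasStrongType T ∞ μ := by
  refine ⟨1, fun f _ => ?_⟩
  rw [eLpNorm_exponent_top, ENNReal.coe_one, one_mul]
  exact essSup_le_of_ae_le _ (Filter.Eventually.of_forall (h f))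

theorem hasWeakType_top_iff {X : Type*} [MeasurableSpace X] {T : (X → ℝ) → X → ℝ≥0∞}
    {μ : Measure X} : HasWeakType T ∞ μ ↔ HasStrongType T ∞ μ := by
  simp [HasWeakType, HasStrongType, weakLpNorm]

/-! ### The metric space of subdivided stars. -/

/-- A disjoint union, indexed by `K`, of stars whose edges are subdivided: in the star `k` the
hub is joined to the mid vertices, and each mid vertex to the tip vertex with the same
index. -/
inductive StarPoint (K : Type) (I : K → Type) : Type
  | hub (k : K) : StarPoint K I
  | mid (k : K) (i : I k) : StarPoint K I
  | tip (k : K) (i : I k) : StarPoint K I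

namespace StarPoint

variable {K : Type} {I : K → Type}

/-- The index of the star that contains a point. -/
def base : StarPoint K I → K
  | hub k => k
  | mid k _ => k
  | tip k _ => k

/-- The closed neighborhood of a vertex. -/
def nbhd : StarPoint K I → Set (StarPoint K I)
  | hub k => insert (hub k) (range (mid k))
  | mid k i => {hub k, mid k i, tip k i}
  | tip k i => {mid k i, tip k i}

theorem mem_nbhd_self (x : StarPoint K I) : x ∈ nbhd x := by
  cases x <;> simp [nbhd]

theorem mem_nbhd_comm {x y : StarPoint K I} (h : y ∈ nbhd x) : x ∈ nbhd y := by
  cases x <;> cases y <;> simp [nbhd] at h ⊢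
  case mid.hub => subst h; exact ⟨rfl, _, HEq.rfl⟩
  all_goals grind

theorem base_eq_of_mem_nbhd {x y : StarPoint K I} (h : x ∈ nbhd y) : base x = base y := by
  cases x <;> cases y <;> simp [nbhd, base] at h ⊢ <;> grind

-- The triangle inequality is automatic because all nonzero distances lie in [1, 2]; in particular
-- points of different stars are at distance 2.
open Classical in
noncomputable instance : MetricSpace (StarPoint K I) where
  dist x y := if x = y then 0 else if y ∈ nbhd x then 1 else 2
  dist_self x := by simp
  dist_comm x y := by
    have : y ∈ nbhd x ↔ x ∈ nbhd y := ⟨mem_nbhd_comm, mem_nbhd_comm⟩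
    simp only [this, eq_comm (a := x)]
  dist_triangle x y z := by
    split_ifs <;> first | (exfalso; simp_all; done) | norm_num
  eq_of_dist_eq_zero {x y} h := by
    by_contra hxy
    simp only [hxy, if_false] at h
    split_ifs at h <;> norm_num at h

open Classical in
theorem dist_def (x y : StarPoint K I) :
    dist x y = if x = y then 0 else if y ∈ nbhd x then 1 else 2 := rfl

theorem ball_eq_singleton (x : StarPoint K I) {r : ℝ} (h0 : 0 < r) (h1 : r ≤ 1) :
    Metric.ball x r = {x} := by
  ext y
  rw [Metric.mem_ball', dist_def, mem_singleton_iff, eq_comm]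
  split_ifs
  · simp_all
  · simp_all
  · simp_all; linarith

theorem ball_eq_nbhd (x : StarPoint K I) {r : ℝ} (h1 : 1 < r) (h2 : r ≤ 2) :
    Metric.ball x r = nbhd x := by
  ext y
  rw [Metric.mem_ball', dist_def]
  have := mem_nbhd_self x
  split_ifs with h h'
  · simp_all; linarith
  · simp_all
  · simp_all

theorem ball_eq_univ (x : StarPoint K I) {r : ℝ} (h2 : 2 < r) :
    Metric.ball x r = univ := by
  ext y
  rw [Metric.mem_ball', dist_def]
  simp only [mem_univ, iff_true]
  split_ifs <;> linarith

instance : DiscreteTopology (StarPoint K I) :=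
  discreteTopology_iff_isOpen_singleton.2 fun x => by
    rw [← ball_eq_singleton x zero_lt_one le_rfl]
    exact Metric.isOpen_ball

instance : MeasurableSpace (StarPoint K I) := ⊤

instance : DiscreteMeasurableSpace (StarPoint K I) := ⟨fun _ => trivial⟩

instance : BorelSpace (StarPoint K I) := ⟨(borel_eq_top_of_discrete).symm⟩

end StarPoint

/-! ### The measure and averages over neighborhoods. -/

/-- Masses on a union of subdivided stars: `a` and `b` are the masses of the mid and tip
vertices relative to the mass `W` of the hub of their star. -/
structure StarWeights (K : Type) (I : K → Type) [∀ k, Fintype (I k)] where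
  W : K → ℝ≥0
  a : ∀ k, I k → ℝ≥0
  b : ∀ k, I k → ℝ≥0
  W_pos : ∀ k, 0 < W k
  a_pos : ∀ k i, 0 < a k i
  b_pos : ∀ k i, 0 < b k i
  one_le : ∀ k i, 1 ≤ a k i + b k i
  summable : ∑' k, (W k : ℝ≥0∞) * (1 + ∑ i, ((a k i : ℝ≥0∞) + b k i)) ≠ ∞

namespace StarWeights

open StarPoint

variable {K : Type} {I : K → Type} [∀ k, Fintype (I k)] (w : StarWeights K I)

/-- The measure on the star `k`, normalized so that the hub has mass one. -/
noncomputable def starMeasure (k : K) : Measure (StarPoint K I) :=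
  Measure.dirac (hub k) + ∑ i, ((w.a k i : ℝ≥0∞) • Measure.dirac (mid k i) +
    (w.b k i : ℝ≥0∞) • Measure.dirac (tip k i))

/-- The measure on the whole union of stars. -/
noncomputable def measure : Measure (StarPoint K I) :=
  Measure.sum fun k => (w.W k : ℝ≥0∞) • w.starMeasure k

theorem lintegral_starMeasure (k : K) (F : StarPoint K I → ℝ≥0∞) :
    ∫⁻ x, F x ∂w.starMeasure k =
      F (hub k) + ∑ i, (w.a k i * F (mid k i) + w.b k i * F (tip k i)) := by
  simp [starMeasure, lintegral_add_measure, lintegral_finsetSum_measure]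
  simp only [ENNReal.smul_def, smul_eq_mul]

theorem lintegral_measure (F : StarPoint K I → ℝ≥0∞) :
    ∫⁻ x, F x ∂w.measure = ∑' k, w.W k * ∫⁻ x, F x ∂w.starMeasure k := by
  simp [measure, lintegral_sum_measure]
  simp only [ENNReal.smul_def, smul_eq_mul]

theorem measure_apply (s : Set (StarPoint K I)) :
    w.measure s = ∑' k, w.W k * w.starMeasure k s := by
  simp [measure, Measure.sum_apply]

theorem ae_base_eq (k : K) : ∀ᵐ x ∂w.starMeasure k, base x = k := by
  rw [ae_iff, ← lintegral_indicator_one (MeasurableSet.of_discrete), lintegral_starMeasure]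
  simp [base, indicator]

theorem setLIntegral_measure {k : K} {s : Set (StarPoint K I)} (hs : ∀ x ∈ s, base x = k)
    (F : StarPoint K I → ℝ≥0∞) :
    ∫⁻ x in s, F x ∂w.measure = w.W k * ∫⁻ x in s, F x ∂w.starMeasure k := by
  rw [← lintegral_indicator MeasurableSet.of_discrete,
    ← lintegral_indicator MeasurableSet.of_discrete, lintegral_measure, tsum_eq_single k]
  intro k' hk'
  rw [lintegral_eq_zero_of_ae_eq_zero, mul_zero]
  filter_upwards [w.ae_base_eq k'] with x hx
  exact indicator_of_notMem (fun h => hk' (hx ▸ hs x h)) _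

/-- The average of `F` over the closed neighborhood of a vertex. -/
noncomputable def nbhdAvg (F : StarPoint K I → ℝ≥0∞) (x : StarPoint K I) : ℝ≥0∞ :=
  (∫⁻ y in nbhd x, F y ∂w.measure) / w.measure (nbhd x)

theorem lintegral_nbhd (x : StarPoint K I) (F : StarPoint K I → ℝ≥0∞) :
    ∫⁻ y in nbhd x, F y ∂w.measure = w.W (base x) * match x with
      | hub k => F (hub k) + ∑ i, w.a k i * F (mid k i)
      | mid k i => F (hub k) + (w.a k i * F (mid k i) + w.b k i * F (tip k i))
      | tip k i => w.a k i * F (mid k i) + w.b k i * F (tip k i) := by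
  classical
  obtain ⟨k, hk⟩ : ∃ k, base x = k := ⟨_, rfl⟩
  rw [w.setLIntegral_measure (fun y hy => (base_eq_of_mem_nbhd hy).trans hk),
    ← lintegral_indicator MeasurableSet.of_discrete, lintegral_starMeasure, hk]
  cases x <;> simp only [base] at hk <;> subst hk <;>
    simp [nbhd, indicator, Finset.sum_add_distrib]

/-- A neighborhood stays in one star, so the hub mass `W` cancels: averages depend only on the
relative masses, and `W` remains free to ensure finiteness. -/
theorem nbhdAvg_eq (x : StarPoint K I) (F : StarPoint K I → ℝ≥0∞) :
    w.nbhdAvg F x = match x with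
      | hub k => (F (hub k) + ∑ i, w.a k i * F (mid k i)) / (1 + ∑ i, (w.a k i : ℝ≥0∞))
      | mid k i => (F (hub k) + (w.a k i * F (mid k i) + w.b k i * F (tip k i))) /
          (1 + (w.a k i + w.b k i))
      | tip k i => (w.a k i * F (mid k i) + w.b k i * F (tip k i)) /
          (w.a k i + w.b k i) := by
  have hW : ∀ k, (w.W k : ℝ≥0∞) ≠ 0 := fun k => by exact_mod_cast (w.W_pos k).ne'
  rw [nbhdAvg, ← setLIntegral_one, lintegral_nbhd, lintegral_nbhd,
    ENNReal.mul_div_mul_left _ _ (hW _) ENNReal.coe_ne_top]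
  cases x <;> simp

theorem measure_univ_ne_top : w.measure univ ≠ ∞ := by
  rw [← lintegral_one, lintegral_measure]
  simpa only [lintegral_starMeasure, mul_one] using w.summable

instance : IsFiniteMeasure w.measure := ⟨w.measure_univ_ne_top.lt_top⟩

theorem measure_singleton (x : StarPoint K I) :
    w.measure {x} = w.W (base x) * match x with
      | hub _ => 1
      | mid k i => w.a k i
      | tip k i => w.b k i := by
  classical
  obtain ⟨k, hk⟩ : ∃ k, base x = k := ⟨_, rfl⟩
  rw [← setLIntegral_one, w.setLIntegral_measure (k := k) (by simpa using hk),
    ← lintegral_indicator MeasurableSet.of_discrete, lintegral_starMeasure, hk]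
  cases x <;> simp only [base] at hk <;> subst hk <;> simp [indicator]

theorem measure_singleton_ne_zero (x : StarPoint K I) : w.measure {x} ≠ 0 := by
  rw [measure_singleton]
  cases x <;> simp [base] <;> simp [(w.W_pos _).ne', (w.a_pos _ _).ne', (w.b_pos _ _).ne']

theorem ballsPosFinite : BallsPosFinite w.measure := fun x r hr =>
  ⟨lt_of_lt_of_le (pos_iff_ne_zero.2 (w.measure_singleton_ne_zero x))
    (measure_mono (by simpa using hr)), measure_lt_top _ _⟩

theorem not_isDoublingMeasure [Infinite K] : ¬ IsDoublingMeasure w.measure := by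
  rintro ⟨C, hC⟩
  -- Doubling twice, from radius 1 to radius 4, turns the hub alone into the whole space. Hence `W`
  -- would be bounded below, which contradicts its summability over infinitely many stars.
  have key : ∀ k, w.measure univ ≤ C * (C * w.W k) := fun k => by
    have h1 := hC (hub k) 1 one_pos
    have h2 := hC (hub k) 2 two_pos
    rw [mul_one, ball_eq_singleton _ one_pos le_rfl, measure_singleton] at h1
    rw [ball_eq_univ _ (by norm_num)] at h2
    simp only [mul_one] at h1
    exact h2.trans (by gcongr; exact h1)
  have h0 : w.measure univ ≠ 0 := by
    obtain ⟨k⟩ := (inferInstance : Nonempty K)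
    exact fun h => w.measure_singleton_ne_zero (hub k) (measure_mono_null (subset_univ _) h)
  have h1 : ∑' _ : K, w.measure univ ≤ ∑' k, C * (C * (w.W k : ℝ≥0∞)) := ENNReal.tsum_le_tsum key
  rw [ENNReal.tsum_const_eq_top_of_ne_zero h0, ENNReal.tsum_mul_left, ENNReal.tsum_mul_left,
    top_le_iff] at h1
  refine ENNReal.mul_ne_top ENNReal.coe_ne_top (ENNReal.mul_ne_top ENNReal.coe_ne_top ?_) h1
  refine ne_top_of_le_ne_top w.summable (ENNReal.tsum_le_tsum fun k => ?_)
  exact le_mul_of_one_le_right' le_self_add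

end StarWeights

/-! ### Reduction of both maximal operators to the function `decay`. -/

namespace StarWeights

open StarPoint

variable {K : Type} {I : K → Type} [∀ k, Fintype (I k)] (w : StarWeights K I)

/-- The contribution of the neighborhoods of hubs and tips to the maximal functions, up to the
replacement of suprema by sums. -/
noncomputable def localAvg (Φ : StarPoint K I → ℝ≥0∞) : StarPoint K I → ℝ≥0∞
  | hub k => w.nbhdAvg Φ (hub k) + ∑ i, w.nbhdAvg Φ (tip k i)
  | mid k i => w.nbhdAvg Φ (hub k) + w.nbhdAvg Φ (tip k i)
  | tip k i => w.nbhdAvg Φ (tip k i)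

/-- The contribution of all balls except the neighborhoods of the vertices `mid k i`. -/
noncomputable def tameMaximal (Φ : StarPoint K I → ℝ≥0∞) (x : StarPoint K I) : ℝ≥0∞ :=
  Φ x + (∫⁻ y, Φ y ∂w.measure) / w.measure univ + w.localAvg Φ x

/-- The size at `x` of the maximal function of a unit mass at the hub of the star of `x`; here
`θ = 0` for the centered operator and `θ = 1` for the non-centered one. -/
noncomputable def decay (θ : ℝ≥0∞) : StarPoint K I → ℝ≥0∞
  | hub _ => 1
  | mid k i => (1 + (w.a k i + w.b k i) : ℝ≥0∞)⁻¹
  | tip k i => θ * (1 + (w.a k i + w.b k i) : ℝ≥0∞)⁻¹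

theorem coe_one_le (k : K) (i : I k) : (1 : ℝ≥0∞) ≤ w.a k i + w.b k i := by
  exact_mod_cast w.one_le k i

theorem nbhdAvg_hub_mul (Φ : StarPoint K I → ℝ≥0∞) (k : K) :
    w.nbhdAvg Φ (hub k) * (1 + ∑ i, (w.a k i : ℝ≥0∞)) =
      Φ (hub k) + ∑ i, w.a k i * Φ (mid k i) := by
  rw [nbhdAvg_eq]
  exact ENNReal.div_mul_cancel (by simp) (by simp [ENNReal.add_eq_top, ENNReal.sum_eq_top])

theorem nbhdAvg_tip_mul (Φ : StarPoint K I → ℝ≥0∞) (k : K) (i : I k) :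
    w.nbhdAvg Φ (tip k i) * (w.a k i + w.b k i) =
      w.a k i * Φ (mid k i) + w.b k i * Φ (tip k i) := by
  rw [nbhdAvg_eq]
  exact ENNReal.div_mul_cancel (zero_lt_one.trans_le (w.coe_one_le k i)).ne'
    (by simp [ENNReal.add_eq_top])

/-- Each average is charged to the integral over its own neighborhood. Hub averages on the hub
neighborhood, tip averages on the tip neighborhoods, and tip averages at the hub each cost at most
one full integral. -/
theorem lintegral_localAvg_le (Φ : StarPoint K I → ℝ≥0∞) (k : K) :
    ∫⁻ x, w.localAvg Φ x ∂w.starMeasure k ≤ 3 * ∫⁻ x, Φ x ∂w.starMeasure k := by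
  set H := w.nbhdAvg Φ (hub k) with hH
  set t := fun i => w.nbhdAvg Φ (tip k i) with ht
  have h1 := w.nbhdAvg_hub_mul Φ k
  have h2 : ∑ i, t i * (w.a k i + w.b k i) =
      ∑ i, (w.a k i * Φ (mid k i) + w.b k i * Φ (tip k i)) :=
    Finset.sum_congr rfl fun i _ => w.nbhdAvg_tip_mul Φ k i
  -- The assumption `1 ≤ a + b` lets the tip neighborhood pay for its average being counted at the
  -- hub, of relative mass one.
  have h3 : ∑ i, t i ≤ ∑ i, t i * (w.a k i + w.b k i) :=
    Finset.sum_le_sum fun i _ => le_mul_of_one_le_right' (w.coe_one_le k i)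
  have h4 : ∑ i, w.a k i * Φ (mid k i) ≤
      ∑ i, (w.a k i * Φ (mid k i) + w.b k i * Φ (tip k i)) :=
    Finset.sum_le_sum fun i _ => le_self_add
  rw [lintegral_starMeasure, lintegral_starMeasure]
  calc _ = H * (1 + ∑ i, (w.a k i : ℝ≥0∞)) + ∑ i, t i + ∑ i, t i * (w.a k i + w.b k i) := by
        simp only [localAvg, mul_add, Finset.sum_add_distrib, Finset.mul_sum, ← hH, ht,
          mul_one]
        simp only [mul_comm]
        ring
    _ ≤ (Φ (hub k) + ∑ i, (w.a k i * Φ (mid k i) + w.b k i * Φ (tip k i))) +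
        ∑ i, (w.a k i * Φ (mid k i) + w.b k i * Φ (tip k i)) +
        ∑ i, (w.a k i * Φ (mid k i) + w.b k i * Φ (tip k i)) := by
      rw [h1, h2]
      exact add_le_add_left (add_le_add (add_le_add_right h4 _) (h3.trans_eq h2)) _
    _ ≤ (Φ (hub k) + ∑ i, (w.a k i * Φ (mid k i) + w.b k i * Φ (tip k i))) +
        (Φ (hub k) + ∑ i, (w.a k i * Φ (mid k i) + w.b k i * Φ (tip k i))) +
        (Φ (hub k) + ∑ i, (w.a k i * Φ (mid k i) + w.b k i * Φ (tip k i))) := by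
      gcongr <;> exact le_add_self
    _ = _ := by ring

theorem lintegral_tameMaximal_le (Φ : StarPoint K I → ℝ≥0∞) :
    ∫⁻ x, w.tameMaximal Φ x ∂w.measure ≤ 5 * ∫⁻ x, Φ x ∂w.measure := by
  have h : ∫⁻ x, w.localAvg Φ x ∂w.measure ≤ 3 * ∫⁻ x, Φ x ∂w.measure := by
    rw [lintegral_measure, lintegral_measure, ← ENNReal.tsum_mul_left]
    refine ENNReal.tsum_le_tsum fun k => ?_
    rw [mul_left_comm]
    gcongr
    exact w.lintegral_localAvg_le Φ k
  unfold tameMaximal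
  rw [lintegral_add_left .of_discrete, lintegral_add_left .of_discrete, lintegral_const]
  calc _ ≤ ∫⁻ x, Φ x ∂w.measure + ∫⁻ x, Φ x ∂w.measure + 3 * ∫⁻ x, Φ x ∂w.measure := by
        gcongr
        rw [mul_comm]
        exact ENNReal.mul_div_le
    _ = _ := by ring

/-- Dropping the hub from the denominator leaves a tip average; the hub's own contribution is the
only dangerous term. -/
theorem nbhdAvg_mid_le (F : StarPoint K I → ℝ≥0∞) (k : K) (i : I k) :
    w.nbhdAvg F (mid k i) ≤
      w.nbhdAvg F (tip k i) + (1 + (w.a k i + w.b k i) : ℝ≥0∞)⁻¹ * F (hub k) := by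
  simp only [nbhdAvg_eq]
  rw [ENNReal.add_div, add_comm]
  exact add_le_add (ENNReal.div_le_div_left le_add_self _) (by rw [div_eq_mul_inv, mul_comm])

theorem nbhdAvg_le_rpow (F : StarPoint K I → ℝ≥0∞) (x : StarPoint K I) {q : ℝ} (hq : 1 ≤ q) :
    w.nbhdAvg F x ≤ w.nbhdAvg (fun y => F y ^ q) x ^ (1 / q) := by
  have h := lintegral_div_measure_univ_le (w.measure.restrict (nbhd x)) (F := F)
    Measurable.of_discrete.aemeasurable (by
      rw [Measure.restrict_apply_univ]
      exact fun h => w.measure_singleton_ne_zero x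
        (measure_mono_null (singleton_subset_iff.2 (mem_nbhd_self x)) h))
    (measure_ne_top _ _) hq
  rwa [Measure.restrict_apply_univ] at h

theorem nbhdAvg_le_tameMaximal (Φ : StarPoint K I → ℝ≥0∞) {x : StarPoint K I} {k : K} {i : I k}
    (hx : x ∈ nbhd (mid k i)) : w.nbhdAvg Φ (tip k i) ≤ w.tameMaximal Φ x := by
  refine le_add_left ?_
  have : x = hub k ∨ x = mid k i ∨ x = tip k i := hx
  rcases this with rfl | rfl | rfl
  · exact le_add_left (Finset.single_le_sum (f := fun i => w.nbhdAvg Φ (tip k i))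
      (fun _ _ => zero_le) (Finset.mem_univ i))
  · exact le_add_self
  · exact le_rfl

/-- All balls except the triples around mids are absorbed by `tameMaximal` through Jensen. When the
ball is centered at `x`, a triple occurs only for `x` a mid, where `decay θ` does not involve `θ`;
this is why `θ = 0` suffices there. -/
theorem ballAverage_le {θ : ℝ≥0∞} (f : StarPoint K I → ℝ) {x z : StarPoint K I} {r : ℝ}
    (hx : x ∈ Metric.ball z r) (hθ : θ = 1 ∨ z = x) {q : ℝ} (hq : 1 ≤ q) :
    ballAverage w.measure f z r ≤
      w.tameMaximal (fun y => ‖f y‖ₑ ^ q) x ^ (1 / q) + w.decay θ x * ‖f (hub (base x))‖ₑ := by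
  have hq0 : 0 < q := by linarith
  have hr : 0 < r := Metric.pos_of_mem_ball hx
  have jensen : ∀ y, w.nbhdAvg (fun y => ‖f y‖ₑ ^ q) y ≤ w.tameMaximal (fun y => ‖f y‖ₑ ^ q) x →
      w.nbhdAvg (fun y => ‖f y‖ₑ) y ≤ w.tameMaximal (fun y => ‖f y‖ₑ ^ q) x ^ (1 / q) :=
    fun y hy => (w.nbhdAvg_le_rpow _ y hq).trans (by gcongr)
  rcases le_or_gt r 1 with h1 | h1
  · rw [ball_eq_singleton z hr h1, mem_singleton_iff] at hx
    subst hx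
    refine le_add_right ?_
    have h2 := w.measure_singleton_ne_zero x
    rw [ballAverage, ball_eq_singleton x hr h1, lintegral_singleton,
      ENNReal.mul_div_cancel_right h2 (measure_ne_top _ _)]
    calc ‖f x‖ₑ = (‖f x‖ₑ ^ q) ^ (1 / q) := by
          rw [← ENNReal.rpow_mul, mul_one_div_cancel hq0.ne', ENNReal.rpow_one]
      _ ≤ _ := by
        gcongr
        exact le_add_right le_self_add
  rcases le_or_gt r 2 with h2 | h2
  · rw [ball_eq_nbhd z h1 h2] at hx
    rw [ballAverage, ball_eq_nbhd z h1 h2]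
    change w.nbhdAvg (fun y => ‖f y‖ₑ) z ≤ _
    cases z with
    | hub k =>
      refine le_add_right (jensen _ (le_add_left ?_))
      obtain rfl | ⟨i, rfl⟩ : x = hub k ∨ ∃ i, mid k i = x := hx <;> exact le_self_add
    | tip k i =>
      exact le_add_right (jensen _ (w.nbhdAvg_le_tameMaximal _ (subset_insert _ _ hx)))
    | mid k i =>
      refine (w.nbhdAvg_mid_le _ k i).trans
        (add_le_add (jensen _ (w.nbhdAvg_le_tameMaximal _ hx)) ?_)
      rw [base_eq_of_mem_nbhd hx]
      gcongr
      · rcases hθ with rfl | rfl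
        · obtain rfl | rfl | rfl : x = hub k ∨ x = mid k i ∨ x = tip k i := hx
          · exact ENNReal.inv_le_one.2 le_self_add
          · exact le_rfl
          · exact (one_mul _).ge
        · exact le_rfl
      · exact le_rfl
  · refine le_add_right ?_
    rw [ballAverage, ball_eq_univ z h2, Measure.restrict_univ]
    refine (lintegral_div_measure_univ_le w.measure Measurable.of_discrete.aemeasurable ?_
      (measure_ne_top _ _) hq).trans ?_
    · exact fun h => w.measure_singleton_ne_zero x (measure_mono_null (subset_univ _) h)
    · gcongr
      exact le_add_right le_add_self

/-- Two-sided control of an operator by `tameMaximal` and `decay θ`. -/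
structure IsControlled (T : (StarPoint K I → ℝ) → StarPoint K I → ℝ≥0∞) (θ : ℝ≥0∞) : Prop where
  le : ∀ (f : StarPoint K I → ℝ) (x : StarPoint K I) (q : ℝ), 1 ≤ q →
    T f x ≤
      w.tameMaximal (fun y => ‖f y‖ₑ ^ q) x ^ (1 / q) + w.decay θ x * ‖f (hub (base x))‖ₑ
  ge : ∀ x, w.decay θ x ≤ T (indicator {hub (base x)} 1) x

omit [∀ k, Fintype (I k)] in
theorem enorm_indicator_hub (k : K) (x : StarPoint K I) :
    ‖(indicator {hub k} 1 : StarPoint K I → ℝ) x‖ₑ = indicator {hub k} 1 x := by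
  by_cases h : x = hub k <;> simp [h]

theorem ballAverage_indicator_hub (k : K) {r : ℝ} (h0 : 0 < r) (h1 : r ≤ 1) :
    ballAverage w.measure (indicator {hub k} 1) (hub k) r = 1 := by
  rw [ballAverage, ball_eq_singleton _ h0 h1, lintegral_singleton,
    ENNReal.mul_div_cancel_right (w.measure_singleton_ne_zero _) (measure_ne_top _ _)]
  simp

theorem ballAverage_indicator_mid (k : K) (i : I k) :
    ballAverage w.measure (indicator {hub k} 1) (mid k i) 2 =
      (1 + (w.a k i + w.b k i) : ℝ≥0∞)⁻¹ := by
  simp only [ballAverage, ball_eq_nbhd (mid k i) one_lt_two le_rfl, enorm_indicator_hub]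
  change w.nbhdAvg (indicator {hub k} 1) (mid k i) = _
  simp [nbhdAvg_eq]

theorem isControlled_centeredMaximal : w.IsControlled (centeredMaximal w.measure) 0 where
  le f x q hq := iSup₂_le fun _ hr =>
    w.ballAverage_le f (Metric.mem_ball_self hr) (.inr rfl) hq
  ge x := by
    cases x with
    | hub k =>
      exact le_iSup₂_of_le 1 one_pos (w.ballAverage_indicator_hub k one_pos le_rfl).ge
    | mid k i => exact le_iSup₂_of_le 2 two_pos (w.ballAverage_indicator_mid k i).ge
    | tip k i => simp [decay]

theorem isControlled_noncenteredMaximal : w.IsControlled (noncenteredMaximal w.measure) 1 where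
  le f x q hq := iSup_le fun _ => iSup₂_le fun _ hr => w.ballAverage_le f hr (.inl rfl) hq
  ge x := by
    cases x with
    | hub k =>
      exact le_iSup_of_le (hub k) <| le_iSup₂_of_le 1 (Metric.mem_ball_self one_pos)
        (w.ballAverage_indicator_hub k one_pos le_rfl).ge
    | mid k i =>
      exact le_iSup_of_le (mid k i) <| le_iSup₂_of_le 2 (Metric.mem_ball_self two_pos)
        (w.ballAverage_indicator_mid k i).ge
    | tip k i =>
      refine le_iSup_of_le (mid k i) <| le_iSup₂_of_le 2 ?_
        ((one_mul _).trans (w.ballAverage_indicator_mid k i).symm).le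
      rw [ball_eq_nbhd _ one_lt_two le_rfl]
      simp [nbhd]

theorem lintegral_indicator_hub (k : K) {q : ℝ} (hq : 0 < q) :
    ∫⁻ x, ‖(indicator {hub k} 1 : StarPoint K I → ℝ) x‖ₑ ^ q ∂w.measure = w.W k := by
  have : ∀ x, ‖(indicator {hub k} 1 : StarPoint K I → ℝ) x‖ₑ ^ q =
      indicator {hub k} (fun _ => 1) x := fun x => by
    by_cases h : x = hub k <;> simp [h, hq]
  simp only [this]
  rw [lintegral_indicator .of_discrete, setLIntegral_one, measure_singleton]
  simp [base]

theorem memLp_indicator_hub (k : K) (p : ℝ≥0∞) :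
    MemLp (indicator {hub k} 1 : StarPoint K I → ℝ) p w.measure :=
  memLp_indicator_const p .of_discrete 1 (.inr (measure_ne_top _ _))

theorem le_lintegral_starMeasure (F : StarPoint K I → ℝ≥0∞) (k : K) :
    F (hub k) ≤ ∫⁻ x, F x ∂w.starMeasure k := by
  rw [lintegral_starMeasure]
  exact le_self_add

theorem W_mul_le_lintegral (F : StarPoint K I → ℝ≥0∞) (k : K) :
    w.W k * ∫⁻ x, F x ∂w.starMeasure k ≤ ∫⁻ x, F x ∂w.measure := by
  rw [lintegral_measure]
  exact ENNReal.le_tsum (f := fun k => w.W k * ∫⁻ x, F x ∂w.starMeasure k) k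

theorem W_mul_le_measure (s : Set (StarPoint K I)) (k : K) :
    w.W k * w.starMeasure k s ≤ w.measure s := by
  rw [measure_apply]
  exact ENNReal.le_tsum (f := fun k => w.W k * w.starMeasure k s) k

theorem le_of_W_mul_le {k : K} {c d : ℝ≥0∞} (h : w.W k * c ≤ d * w.W k) : c ≤ d := by
  rw [mul_comm d] at h
  exact (ENNReal.mul_le_mul_iff_right (by exact_mod_cast (w.W_pos k).ne')
    ENNReal.coe_ne_top).1 h

variable {w}

/-- Necessity tests `T` on indicators of hubs, where `W` cancels. For sufficiency, on each star the
dangerous term is `decay` times a constant already controlled by the mass of `f` at the hub. -/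
theorem IsControlled.hasStrongType_iff {T : (StarPoint K I → ℝ) → StarPoint K I → ℝ≥0∞}
    {θ : ℝ≥0∞} (hT : w.IsControlled T θ) {p : ℝ≥0∞} (hp : 1 ≤ p) (hp' : p ≠ ∞) :
    HasStrongType T p w.measure ↔
      ∃ C : ℝ≥0, ∀ k, ∫⁻ x, w.decay θ x ^ p.toReal ∂w.starMeasure k ≤ C := by
  have hq : 1 ≤ p.toReal := by
    simpa using ENNReal.toReal_mono hp' hp
  rw [_root_.hasStrongType_iff hp hp']
  generalize hqp : p.toReal = q at hq ⊢
  have hq0 : 0 < q := by linarith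
  constructor
  · rintro ⟨C, hC⟩
    refine ⟨C, fun k => w.le_of_W_mul_le (k := k) ?_⟩
    have h := hC _ (w.memLp_indicator_hub k p)
    rw [lintegral_indicator_hub w k hq0] at h
    refine (le_trans ?_ (w.W_mul_le_lintegral _ k)).trans h
    refine mul_le_mul_right (lintegral_mono_ae ?_) _
    filter_upwards [w.ae_base_eq k] with x hx
    gcongr
    exact hx ▸ hT.ge x
  · rintro ⟨C, hC⟩
    -- The power of 2 comes from convexity of `s ↦ s ^ q`, the 5 from `lintegral_tameMaximal_le`.
    refine ⟨2 ^ (q - 1) * (5 + C), fun f _ => ?_⟩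
    set Φ : StarPoint K I → ℝ≥0∞ := fun x => ‖f x‖ₑ ^ q
    have h1 : ∀ x, T f x ^ q ≤
        2 ^ (q - 1) * (w.tameMaximal Φ x + w.decay θ x ^ q * Φ (hub (base x))) := fun x =>
      calc T f x ^ q ≤ _ := ENNReal.rpow_le_rpow (hT.le f x q hq) hq0.le
        _ ≤ _ := ENNReal.rpow_add_le_mul_rpow_add_rpow _ _ hq
        _ = _ := by
          rw [← ENNReal.rpow_mul, one_div_mul_cancel hq0.ne', ENNReal.rpow_one,
            ENNReal.mul_rpow_of_nonneg _ _ hq0.le]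
    have h2 : ∫⁻ x, w.decay θ x ^ q * Φ (hub (base x)) ∂w.measure ≤ C * ∫⁻ x, Φ x ∂w.measure := by
      rw [lintegral_measure, lintegral_measure, ← ENNReal.tsum_mul_left]
      refine ENNReal.tsum_le_tsum fun k => ?_
      rw [mul_left_comm]
      gcongr
      calc ∫⁻ x, w.decay θ x ^ q * Φ (hub (base x)) ∂w.starMeasure k
          = ∫⁻ x, w.decay θ x ^ q * Φ (hub k) ∂w.starMeasure k := by
            refine lintegral_congr_ae ?_
            filter_upwards [w.ae_base_eq k] with x hx
            rw [hx]
        _ = (∫⁻ x, w.decay θ x ^ q ∂w.starMeasure k) * Φ (hub k) :=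
            lintegral_mul_const _ .of_discrete
        _ ≤ _ := mul_le_mul' (hC k) (w.le_lintegral_starMeasure Φ k)
    calc ∫⁻ x, T f x ^ q ∂w.measure ≤ _ := lintegral_mono h1
      _ = 2 ^ (q - 1) * (∫⁻ x, w.tameMaximal Φ x ∂w.measure +
          ∫⁻ x, w.decay θ x ^ q * Φ (hub (base x)) ∂w.measure) := by
        rw [lintegral_const_mul _ .of_discrete, lintegral_add_left .of_discrete]
      _ ≤ 2 ^ (q - 1) * (5 * ∫⁻ x, Φ x ∂w.measure + C * ∫⁻ x, Φ x ∂w.measure) := by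
        gcongr
        exact w.lintegral_tameMaximal_le Φ
      _ = _ := by
        rw [ENNReal.coe_mul, ENNReal.coe_add, ENNReal.coe_rpow_of_nonneg _ (by linarith)]
        push_cast
        ring

theorem IsControlled.hasWeakType_iff {T : (StarPoint K I → ℝ) → StarPoint K I → ℝ≥0∞}
    {θ : ℝ≥0∞} (hT : w.IsControlled T θ) {p : ℝ≥0∞} (hp : 1 ≤ p) (hp' : p ≠ ∞) :
    HasWeakType T p w.measure ↔
      ∃ C : ℝ≥0, ∀ k, ∀ t : ℝ≥0, 0 < t →
        (t : ℝ≥0∞) ^ p.toReal * w.starMeasure k {x | (t : ℝ≥0∞) < w.decay θ x} ≤ C := by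
  have hq : 1 ≤ p.toReal := by
    simpa using ENNReal.toReal_mono hp' hp
  rw [_root_.hasWeakType_iff hp hp']
  generalize hqp : p.toReal = q at hq ⊢
  have hq0 : 0 < q := by linarith
  constructor
  · rintro ⟨C, hC⟩
    refine ⟨C, fun k t ht => w.le_of_W_mul_le (k := k) ?_⟩
    have h := hC _ (w.memLp_indicator_hub k p) t ht
    rw [lintegral_indicator_hub w k hq0] at h
    refine le_trans ?_ h
    rw [mul_left_comm]
    gcongr
    refine le_trans ?_ (w.W_mul_le_measure _ k)
    refine mul_le_mul_right (measure_mono_ae ?_) _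
    filter_upwards [w.ae_base_eq k] with x hx htx
    exact lt_of_lt_of_le htx (hx ▸ hT.ge x)
  · rintro ⟨C, hC⟩
    refine ⟨2 ^ q * (5 + C), fun f _ t ht => ?_⟩
    set Φ : StarPoint K I → ℝ≥0∞ := fun x => ‖f x‖ₑ ^ q with hΦ
    -- If the sum of the two controlling terms exceeds `2 * s`, one of them exceeds `s`.
    obtain ⟨s, rfl⟩ : ∃ s, t = 2 * s := ⟨t / 2, by rw [mul_div_cancel₀ _ two_ne_zero]⟩
    have hs : 0 < s := by simpa using ht
    have h0 : {x | ((2 * s : ℝ≥0) : ℝ≥0∞) < T f x} ⊆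
        {x | (s : ℝ≥0∞) ^ q ≤ w.tameMaximal Φ x} ∪
          {x | (s : ℝ≥0∞) < w.decay θ x * ‖f (hub (base x))‖ₑ} := by
      intro x hx
      by_contra hcon
      simp only [mem_union, mem_ofPred_eq, not_or, not_le, not_lt] at hcon hx
      refine absurd (hx.trans_le (hT.le f x q hq)) (not_lt.2 ?_)
      rw [two_mul, ENNReal.coe_add]
      refine add_le_add ?_ hcon.2
      calc _ ≤ ((s : ℝ≥0∞) ^ q) ^ (1 / q) := by
            gcongr
            exact hcon.1.le
        _ = s := by rw [← ENNReal.rpow_mul, mul_one_div_cancel hq0.ne', ENNReal.rpow_one]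
    have h1 : (s : ℝ≥0∞) ^ q * w.measure {x | (s : ℝ≥0∞) ^ q ≤ w.tameMaximal Φ x} ≤
        5 * ∫⁻ x, Φ x ∂w.measure :=
      (mul_meas_ge_le_lintegral .of_discrete _).trans (w.lintegral_tameMaximal_le Φ)
    have h2 : (s : ℝ≥0∞) ^ q * w.measure {x | (s : ℝ≥0∞) < w.decay θ x * ‖f (hub (base x))‖ₑ} ≤
        C * ∫⁻ x, Φ x ∂w.measure := by
      rw [measure_apply, lintegral_measure, ← ENNReal.tsum_mul_left, ← ENNReal.tsum_mul_left]
      refine ENNReal.tsum_le_tsum fun k => ?_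
      rw [mul_left_comm, mul_left_comm (C : ℝ≥0∞)]
      refine mul_le_mul_right ?_ _
      refine le_trans ?_ (mul_le_mul_right (w.le_lintegral_starMeasure Φ k) (C : ℝ≥0∞))
      have hae : {x | (s : ℝ≥0∞) < w.decay θ x * ‖f (hub (base x))‖ₑ} ≤ᵐ[w.starMeasure k]
          {x | (s : ℝ≥0∞) < w.decay θ x * ‖f (hub k)‖ₑ} := by
        filter_upwards [w.ae_base_eq k] with x hx h
        have h : (s : ℝ≥0∞) < w.decay θ x * ‖f (hub (base x))‖ₑ := h
        rwa [hx] at h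
      refine (mul_le_mul_right (measure_mono_ae hae) _).trans ?_
      rw [hΦ]
      change _ ≤ (C : ℝ≥0∞) * ‖f (hub k)‖ₑ ^ q
      rw [enorm_eq_nnnorm]
      generalize ‖f (hub k)‖₊ = c
      rcases eq_or_ne c 0 with rfl | hc
      · simp
      have hc' : (c : ℝ≥0∞) ≠ 0 := by exact_mod_cast hc
      -- By homogeneity, the level set of `decay` times the hub value `c` at height `s` is that of
      -- `decay` at height `s / c`.
      have h3 := hC k (s / c) (div_pos hs (pos_iff_ne_zero.2 hc))
      rw [ENNReal.coe_div hc, ENNReal.div_rpow_of_nonneg _ _ hq0.le] at h3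
      have h4 : {x | (s : ℝ≥0∞) < w.decay θ x * c} = {x | (s / c : ℝ≥0∞) < w.decay θ x} := by
        ext x
        exact (ENNReal.div_lt_iff (.inl hc') (.inl ENNReal.coe_ne_top)).symm
      rw [h4]
      calc _ = ((s : ℝ≥0∞) ^ q / (c : ℝ≥0∞) ^ q *
            w.starMeasure k {x | (s / c : ℝ≥0∞) < w.decay θ x}) * (c : ℝ≥0∞) ^ q := by
            rw [mul_right_comm, ENNReal.div_mul_cancel (by simp [hc])
              (by simp [hq0.le])]
        _ ≤ _ := mul_le_mul_left h3 _
    calc _ ≤ ((2 * s : ℝ≥0) : ℝ≥0∞) ^ q * w.measure ({x | (s : ℝ≥0∞) ^ q ≤ w.tameMaximal Φ x} ∪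
          {x | (s : ℝ≥0∞) < w.decay θ x * ‖f (hub (base x))‖ₑ}) :=
         mul_le_mul_right (measure_mono h0) _
      _ ≤ ((2 * s : ℝ≥0) : ℝ≥0∞) ^ q * (w.measure {x | (s : ℝ≥0∞) ^ q ≤ w.tameMaximal Φ x} +
          w.measure {x | (s : ℝ≥0∞) < w.decay θ x * ‖f (hub (base x))‖ₑ}) := by
        gcongr
        exact measure_union_le _ _
      _ = 2 ^ q * ((s : ℝ≥0∞) ^ q * w.measure {x | (s : ℝ≥0∞) ^ q ≤ w.tameMaximal Φ x} +
          (s : ℝ≥0∞) ^ q *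
            w.measure {x | (s : ℝ≥0∞) < w.decay θ x * ‖f (hub (base x))‖ₑ}) := by
        rw [ENNReal.coe_mul, ENNReal.mul_rpow_of_nonneg _ _ hq0.le]
        push_cast
        ring
      _ ≤ 2 ^ q * (5 * ∫⁻ x, Φ x ∂w.measure + C * ∫⁻ x, Φ x ∂w.measure) := by gcongr
      _ = _ := by
        rw [ENNReal.coe_mul, ENNReal.coe_add, ENNReal.coe_rpow_of_nonneg _ hq0.le]
        push_cast
        ring

end StarWeights

/-! ### Leaf counts that realize prescribed exponent sets. -/

/-- The `q`-th moment of the function `j ↦ 2⁻ʲ` for the measure on `{0, …, L k - 1}` with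
masses `N k j * 2 ^ j`. -/
noncomputable def levelSum (L : ℕ → ℕ) (N : ℕ → ℕ → ℕ) (q : ℝ) (k : ℕ) : ℝ≥0 :=
  ∑ j ∈ Finset.range (L k), (N k j : ℝ≥0) * (2 ^ j * (2 ^ j)⁻¹ ^ q)

/-- The weighted distribution function, at height `t`, of the function `j ↦ 2⁻ʲ` for the measure
on `{0, …, L k - 1}` with masses `N k j * 2 ^ j`. -/
noncomputable def levelTail (L : ℕ → ℕ) (N : ℕ → ℕ → ℕ) (q : ℝ) (k : ℕ) (t : ℝ≥0) : ℝ≥0 :=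
  t ^ q * ∑ j ∈ Finset.range (L k), if t < (2 ^ j)⁻¹ then (N k j : ℝ≥0) * 2 ^ j else 0

/-- The finite exponents `q` with uniformly bounded `levelSum` are those in `Ps`, and the ones
with uniformly bounded `levelTail` are those in `Pw`. -/
structure IsProfile (L : ℕ → ℕ) (N : ℕ → ℕ → ℕ) (Ps Pw : Set ℝ≥0∞) : Prop where
  strong : ∀ q : ℝ, 1 ≤ q →
    ((∃ C : ℝ≥0, ∀ k, levelSum L N q k ≤ C) ↔ ENNReal.ofReal q ∈ Ps)
  weak : ∀ q : ℝ, 1 ≤ q →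
    ((∃ C : ℝ≥0, ∀ k, ∀ t : ℝ≥0, 0 < t → levelTail L N q k t ≤ C) ↔ ENNReal.ofReal q ∈ Pw)

theorem levelTail_le_levelSum (L : ℕ → ℕ) (N : ℕ → ℕ → ℕ) {q : ℝ} (hq : 0 ≤ q) (k : ℕ)
    (t : ℝ≥0) : levelTail L N q k t ≤ levelSum L N q k := by
  rw [levelTail, levelSum, Finset.mul_sum]
  refine Finset.sum_le_sum fun j _ => ?_
  split_ifs with h
  · calc t ^ q * (N k j * 2 ^ j) ≤ (2 ^ j)⁻¹ ^ q * (N k j * 2 ^ j) := by gcongr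
      _ = _ := by ring
  · simp

theorem term_le_levelTail (L : ℕ → ℕ) (N : ℕ → ℕ → ℕ) (q : ℝ) {k j : ℕ}
    (hj : j < L k) :
    (N k j : ℝ≥0) * (2 ^ j * (2 ^ j)⁻¹ ^ q) ≤ 2 ^ q * levelTail L N q k ((2 ^ j)⁻¹ / 2) := by
  -- The tail uses a strict inequality, so the height is taken just below `2⁻ʲ`, at the cost of a
  -- factor `2 ^ q`.
  have hlt : ((2 : ℝ≥0) ^ j)⁻¹ / 2 < (2 ^ j)⁻¹ := NNReal.half_lt_self (by positivity)
  have h := Finset.single_le_sum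
    (f := fun i => if ((2 : ℝ≥0) ^ j)⁻¹ / 2 < (2 ^ i)⁻¹ then (N k i : ℝ≥0) * 2 ^ i else 0)
    (fun _ _ => zero_le) (Finset.mem_range.2 hj)
  simp only [hlt, if_true] at h
  calc (N k j : ℝ≥0) * (2 ^ j * (2 ^ j)⁻¹ ^ q)
      = 2 ^ q * (((2 ^ j)⁻¹ / 2) ^ q * (N k j * 2 ^ j)) := by
        have : ((2 : ℝ≥0) ^ j)⁻¹ ^ q = 2 ^ q * ((2 ^ j)⁻¹ / 2) ^ q := by
          rw [← NNReal.mul_rpow, mul_div_cancel₀ _ two_ne_zero]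
        rw [this]
        ring
    _ ≤ _ := by
      unfold levelTail
      gcongr

theorem exists_levelTail_le {L : ℕ → ℕ} {N : ℕ → ℕ → ℕ} {q : ℝ} (hq : 0 ≤ q)
    (h : ∃ C : ℝ≥0, ∀ k, levelSum L N q k ≤ C) :
    ∃ C : ℝ≥0, ∀ k, ∀ t : ℝ≥0, 0 < t → levelTail L N q k t ≤ C := by
  obtain ⟨C, hC⟩ := h
  exact ⟨C, fun k t _ => (levelTail_le_levelSum L N hq k t).trans (hC k)⟩

theorem exists_term_le {L : ℕ → ℕ} {N : ℕ → ℕ → ℕ} {q : ℝ}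
    (h : ∃ C : ℝ≥0, ∀ k, ∀ t : ℝ≥0, 0 < t → levelTail L N q k t ≤ C) :
    ∃ C : ℝ≥0, ∀ k, ∀ j < L k, (N k j : ℝ≥0) * (2 ^ j * (2 ^ j)⁻¹ ^ q) ≤ C := by
  obtain ⟨C, hC⟩ := h
  exact ⟨2 ^ q * C, fun k j hj => (term_le_levelTail L N q hj).trans
    (mul_le_mul_right (hC k _ (by positivity)) _)⟩

theorem two_pow_rpow (s : ℝ) (j : ℕ) : ((2 : ℝ≥0) ^ j) ^ s = (2 ^ s) ^ j := by
  rw [← NNReal.rpow_natCast, ← NNReal.rpow_natCast, ← NNReal.rpow_mul, ← NNReal.rpow_mul, mul_comm]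

/-- The number of leaves of mass `2 ^ j` for which `p₀` is the critical exponent. -/
noncomputable def leafCount (p₀ : ℝ) (j : ℕ) : ℕ := ⌈((2 : ℝ≥0) ^ (p₀ - 1)) ^ j⌉₊

/-- Before rounding up to an integer, level `j` contributes `2 ^ (j (p₀ - q))`: it decays, is
constant or grows according to the sign of `q - p₀`. -/
theorem leafCount_term (p₀ q : ℝ) (j : ℕ) :
    ((2 : ℝ≥0) ^ (p₀ - 1)) ^ j * (2 ^ j * (2 ^ j)⁻¹ ^ q) = (2 ^ (p₀ - q)) ^ j := by
  rw [NNReal.inv_rpow, two_pow_rpow, ← inv_pow, ← NNReal.rpow_neg, ← mul_pow, ← mul_pow]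
  nth_rw 2 [← NNReal.rpow_one 2]
  rw [← NNReal.rpow_add two_ne_zero, ← NNReal.rpow_add two_ne_zero]
  ring_nf

theorem le_leafCount_term (p₀ q : ℝ) (j : ℕ) :
    ((2 : ℝ≥0) ^ (p₀ - q)) ^ j ≤ leafCount p₀ j * (2 ^ j * (2 ^ j)⁻¹ ^ q) := by
  rw [← leafCount_term]
  gcongr
  exact Nat.le_ceil _

theorem leafCount_le {p₀ : ℝ} (hp₀ : 1 ≤ p₀) (j : ℕ) :
    (leafCount p₀ j : ℝ≥0) ≤ 2 * (2 ^ (p₀ - 1)) ^ j := by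
  have h1 : (1 : ℝ≥0) ≤ (2 ^ (p₀ - 1)) ^ j :=
    one_le_pow₀ (NNReal.one_le_rpow one_le_two (by linarith))
  rw [two_mul]
  exact (Nat.ceil_lt_add_one zero_le).le.trans (by gcongr)

theorem leafCount_term_le {p₀ : ℝ} (hp₀ : 1 ≤ p₀) (q : ℝ) (j : ℕ) :
    leafCount p₀ j * (2 ^ j * (2 ^ j)⁻¹ ^ q) ≤ 2 * ((2 : ℝ≥0) ^ (p₀ - q)) ^ j := by
  rw [← leafCount_term, ← mul_assoc 2]
  exact mul_le_mul_left (leafCount_le hp₀ j) _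

theorem two_rpow_lt_one {p₀ q : ℝ} (h : p₀ < q) : (2 : ℝ≥0) ^ (p₀ - q) < 1 :=
  NNReal.rpow_lt_one_of_one_lt_of_neg one_lt_two (by linarith)

theorem sum_pow_le {r : ℝ≥0} (hr : r < 1) (n : ℕ) : ∑ j ∈ Finset.range n, r ^ j ≤ (1 - r)⁻¹ := by
  rw [← NNReal.tsum_geometric hr]
  exact (NNReal.summable_geometric hr).sum_le_tsum _ fun _ _ => zero_le

theorem not_exists_pow_le {p₀ q : ℝ} (h : q < p₀) :
    ¬ ∃ C : ℝ≥0, ∀ j : ℕ, ((2 : ℝ≥0) ^ (p₀ - q)) ^ j ≤ C := by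
  rintro ⟨C, hC⟩
  obtain ⟨n, hn⟩ := pow_unbounded_of_one_lt C
    (NNReal.one_lt_rpow one_lt_two (by linarith : 0 < p₀ - q))
  exact hn.not_ge (hC n)

theorem not_exists_natCast_le : ¬ ∃ C : ℝ≥0, ∀ k : ℕ, (k : ℝ≥0) ≤ C := by
  rintro ⟨C, hC⟩
  obtain ⟨n, hn⟩ := exists_nat_gt C
  exact hn.not_ge (hC n)

/-- The `k` leaves of level 0 have height 1, so every finite moment equals `k`. -/
theorem isProfile_top : IsProfile (fun _ => 1) (fun k _ => k) {∞} {∞} := by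
  have key : ∀ q : ℝ, 1 ≤ q →
      ¬ ∃ C : ℝ≥0, ∀ k, ∀ t : ℝ≥0, 0 < t → levelTail (fun _ => 1) (fun k _ => k) q k t ≤ C := by
    intro q hq h
    obtain ⟨C, hC⟩ := exists_term_le h
    exact not_exists_natCast_le ⟨C, fun k => by simpa using hC k 0 one_pos⟩
  exact ⟨fun q hq => iff_of_false (fun h => key q hq (exists_levelTail_le (by linarith) h))
      (by simp), fun q hq => iff_of_false (key q hq) (by simp)⟩

theorem levelSum_single (M : ℕ → ℕ) (q : ℝ) (k : ℕ) :
    levelSum (fun k => k + 1) (fun k j => if j = k then M k else 0) q k =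
      M k * (2 ^ k * (2 ^ k)⁻¹ ^ q) := by
  simp [levelSum, ite_mul]

theorem ofReal_mem_Icc_top {p₀ q : ℝ} (hq : 1 ≤ q) :
    ENNReal.ofReal q ∈ Icc (ENNReal.ofReal p₀) ∞ ↔ p₀ ≤ q := by
  simp [ENNReal.ofReal_le_ofReal_iff (by linarith : 0 ≤ q)]

theorem ofReal_mem_Ioc_top {p₀ q : ℝ} (hq : 1 ≤ q) :
    ENNReal.ofReal q ∈ Ioc (ENNReal.ofReal p₀) ∞ ↔ p₀ < q := by
  simp [ENNReal.ofReal_lt_ofReal_iff (by linarith : 0 < q)]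

/-- Only level `k` is occupied, so weak and strong norms are comparable, and the single term stays
bounded at the critical exponent. -/
theorem isProfile_Icc_Icc {p₀ : ℝ} (hp₀ : 1 ≤ p₀) :
    IsProfile (fun k => k + 1) (fun k j => if j = k then leafCount p₀ k else 0)
      (Icc (ENNReal.ofReal p₀) ∞) (Icc (ENNReal.ofReal p₀) ∞) := by
  have hpos : ∀ q : ℝ, 1 ≤ q → p₀ ≤ q → ∃ C : ℝ≥0, ∀ k,
      levelSum (fun k => k + 1) (fun k j => if j = k then leafCount p₀ k else 0) q k ≤ C := by
    refine fun q _ hpq => ⟨2, fun k => ?_⟩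
    rw [levelSum_single]
    refine (leafCount_term_le hp₀ q k).trans (mul_le_of_le_one_right' ?_)
    refine pow_le_one₀ zero_le ?_
    exact NNReal.rpow_le_one_of_one_le_of_nonpos one_le_two (by linarith)
  have hneg : ∀ q : ℝ, 1 ≤ q → (∃ C : ℝ≥0, ∀ k, ∀ t : ℝ≥0, 0 < t →
      levelTail (fun k => k + 1) (fun k j => if j = k then leafCount p₀ k else 0) q k t ≤ C) →
      p₀ ≤ q := by
    intro q hq h
    by_contra! hlt
    obtain ⟨C, hC⟩ := exists_term_le h
    refine not_exists_pow_le hlt ⟨C, fun k => (le_leafCount_term p₀ q k).trans ?_⟩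
    simpa using hC k k (Nat.lt_succ_self k)
  refine ⟨fun q hq => ?_, fun q hq => ?_⟩ <;> rw [ofReal_mem_Icc_top hq]
  · exact ⟨fun h => hneg q hq (exists_levelTail_le (by linarith) h), hpos q hq⟩
  · exact ⟨hneg q hq, fun h => exists_levelTail_le (by linarith) (hpos q hq h)⟩

/-- Again a single level, with an extra factor `k + 1` that destroys the critical exponent, weak
type included, but is beaten by geometric decay beyond it. -/
theorem isProfile_Ioc_Ioc {p₀ : ℝ} (hp₀ : 1 ≤ p₀) :
    IsProfile (fun k => k + 1) (fun k j => if j = k then (k + 1) * leafCount p₀ k else 0)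
      (Ioc (ENNReal.ofReal p₀) ∞) (Ioc (ENNReal.ofReal p₀) ∞) := by
  have hpos : ∀ q : ℝ, 1 ≤ q → p₀ < q → ∃ C : ℝ≥0, ∀ k, levelSum (fun k => k + 1)
      (fun k j => if j = k then (k + 1) * leafCount p₀ k else 0) q k ≤ C := by
    intro q _ hpq
    have hr := two_rpow_lt_one hpq
    refine ⟨2 * (1 - (2 : ℝ≥0) ^ (p₀ - q))⁻¹, fun k => ?_⟩
    rw [levelSum_single (fun k => (k + 1) * leafCount p₀ k)]
    push_cast
    calc ((k : ℝ≥0) + 1) * leafCount p₀ k * (2 ^ k * (2 ^ k)⁻¹ ^ q)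
        = ((k : ℝ≥0) + 1) * (leafCount p₀ k * (2 ^ k * (2 ^ k)⁻¹ ^ q)) := by ring
      _ ≤ ((k : ℝ≥0) + 1) * (2 * ((2 : ℝ≥0) ^ (p₀ - q)) ^ k) :=
        mul_le_mul_right (leafCount_term_le hp₀ q k) _
      -- With ratio `r < 1`, the product `(k + 1) * r ^ k` is at most the geometric sum, since `r ^
      -- k` is its smallest term.
      _ = 2 * ∑ _j ∈ Finset.range (k + 1), ((2 : ℝ≥0) ^ (p₀ - q)) ^ k := by
        simp
        ring
      _ ≤ 2 * ∑ j ∈ Finset.range (k + 1), ((2 : ℝ≥0) ^ (p₀ - q)) ^ j := by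
        refine mul_le_mul_right (Finset.sum_le_sum fun j hj => ?_) _
        exact pow_le_pow_of_le_one zero_le hr.le (Nat.lt_succ_iff.1 (Finset.mem_range.1 hj))
      _ ≤ _ := by
        gcongr
        exact sum_pow_le hr _
  have hneg : ∀ q : ℝ, 1 ≤ q → (∃ C : ℝ≥0, ∀ k, ∀ t : ℝ≥0, 0 < t → levelTail (fun k => k + 1)
      (fun k j => if j = k then (k + 1) * leafCount p₀ k else 0) q k t ≤ C) → p₀ < q := by
    intro q hq h
    by_contra! hle
    obtain ⟨C, hC⟩ := exists_term_le h
    refine not_exists_natCast_le ⟨C, fun k => ?_⟩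
    have h1 := hC k k (Nat.lt_succ_self k)
    have h2 : 1 ≤ leafCount p₀ k * (2 ^ k * (2 ^ k : ℝ≥0)⁻¹ ^ q) :=
      (one_le_pow₀ (NNReal.one_le_rpow one_le_two (by linarith))).trans (le_leafCount_term p₀ q k)
    simp only [if_true, Nat.cast_mul, mul_assoc] at h1
    calc (k : ℝ≥0) ≤ ((k + 1 : ℕ) : ℝ≥0) := by simp
      _ ≤ _ := le_mul_of_one_le_right' h2
      _ ≤ C := h1
  refine ⟨fun q hq => ?_, fun q hq => ?_⟩ <;> rw [ofReal_mem_Ioc_top hq]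
  · exact ⟨fun h => hneg q hq (exists_levelTail_le (by linarith) h), hpos q hq⟩
  · exact ⟨hneg q hq, fun h => exists_levelTail_le (by linarith) (hpos q hq h)⟩

theorem sum_pow_le_two_mul {R : ℝ≥0} (hR : 2 ≤ R) (n : ℕ) :
    ∑ j ∈ Finset.range (n + 1), R ^ j ≤ 2 * R ^ n := by
  induction n with
  | zero => simp
  | succ n ih =>
    rw [Finset.sum_range_succ, two_mul]
    gcongr
    refine ih.trans ?_
    rw [pow_succ']
    gcongr

/-- Only levels with `2 ^ j < 1 / t` count, and a geometric sum of ratio at least 2 is at most twice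
its last term. The induction discards top levels until the last one counts. -/
theorem rpow_mul_sum_le {p₀ : ℝ} (hp₀ : 1 ≤ p₀) (t : ℝ≥0) (n : ℕ) :
    t ^ p₀ * ∑ j ∈ Finset.range n, (if t < (2 ^ j)⁻¹ then ((2 : ℝ≥0) ^ p₀) ^ j else 0) ≤ 2 := by
  induction n with
  | zero => simp
  | succ n ih =>
    by_cases h : t < (2 ^ n)⁻¹
    · have hR : (2 : ℝ≥0) ≤ 2 ^ p₀ := by
        simpa using NNReal.rpow_le_rpow_of_exponent_le one_le_two hp₀
      calc _ ≤ t ^ p₀ * ∑ j ∈ Finset.range (n + 1), ((2 : ℝ≥0) ^ p₀) ^ j := by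
            refine mul_le_mul_right (Finset.sum_le_sum fun j _ => ?_) _
            split_ifs
            · exact le_rfl
            · exact zero_le
        _ ≤ t ^ p₀ * (2 * (2 ^ p₀) ^ n) := by
          gcongr
          exact sum_pow_le_two_mul hR n
        _ = 2 * (t * 2 ^ n) ^ p₀ := by
          rw [NNReal.mul_rpow, two_pow_rpow]
          ring
        _ ≤ 2 := by
          refine mul_le_of_le_one_right' (NNReal.rpow_le_one ?_ (by linarith))
          rw [← le_div_iff₀ (by positivity), one_div]
          exact h.le
    · rw [Finset.sum_range_succ, if_neg h, add_zero]
      exact ih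

/-- Occupying all levels below `k` separates the two types: at `p₀` every level adds at least 1 to
the moment, whereas the tail is dominated by its last level. -/
theorem isProfile_Ioc_Icc {p₀ : ℝ} (hp₀ : 1 ≤ p₀) :
    IsProfile (fun k => k) (fun _ j => leafCount p₀ j)
      (Ioc (ENNReal.ofReal p₀) ∞) (Icc (ENNReal.ofReal p₀) ∞) := by
  have hpos : ∀ q : ℝ, 1 ≤ q → p₀ < q → ∃ C : ℝ≥0, ∀ k,
      levelSum (fun k => k) (fun _ j => leafCount p₀ j) q k ≤ C := by
    intro q _ hpq
    have hr := two_rpow_lt_one hpq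
    refine ⟨2 * (1 - (2 : ℝ≥0) ^ (p₀ - q))⁻¹, fun k => ?_⟩
    calc _ ≤ ∑ j ∈ Finset.range k, 2 * ((2 : ℝ≥0) ^ (p₀ - q)) ^ j :=
          Finset.sum_le_sum fun j _ => leafCount_term_le hp₀ q j
      _ ≤ _ := by
        rw [← Finset.mul_sum]
        gcongr
        exact sum_pow_le hr _
  refine ⟨fun q hq => ?_, fun q hq => ?_⟩
  · rw [ofReal_mem_Ioc_top hq]
    refine ⟨fun ⟨C, hC⟩ => ?_, hpos q hq⟩
    by_contra! hle
    refine not_exists_natCast_le ⟨C, fun k => le_trans ?_ (hC k)⟩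
    calc (k : ℝ≥0) = ∑ _j ∈ Finset.range k, 1 := by simp
      _ ≤ _ := Finset.sum_le_sum fun j _ =>
        (one_le_pow₀ (NNReal.one_le_rpow one_le_two (by linarith))).trans (le_leafCount_term p₀ q j)
  · rw [ofReal_mem_Icc_top hq]
    constructor
    · intro h
      by_contra! hlt
      obtain ⟨C, hC⟩ := exists_term_le h
      exact not_exists_pow_le hlt ⟨C, fun j => (le_leafCount_term p₀ q j).trans
        (hC (j + 1) j (Nat.lt_succ_self j))⟩
    · intro hle
      rcases hle.lt_or_eq with hlt | rfl
      · exact exists_levelTail_le (by linarith) (hpos q hq hlt)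
      · refine ⟨2 * 2, fun k t _ => le_trans ?_ (mul_le_mul_right (rpow_mul_sum_le hp₀ t k) 2)⟩
        rw [levelTail, mul_left_comm, Finset.mul_sum _ _ 2]
        refine mul_le_mul_right (Finset.sum_le_sum fun j _ => ?_) _
        split_ifs
        · have : ((2 : ℝ≥0) ^ p₀) ^ j = (2 ^ (p₀ - 1)) ^ j * 2 ^ j := by
            rw [← mul_pow]
            nth_rw 3 [← NNReal.rpow_one 2]
            rw [← NNReal.rpow_add two_ne_zero, sub_add_cancel]
          rw [this, ← mul_assoc]
          exact mul_le_mul_left (leafCount_le hp₀ j) _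
        · simp

theorem IsExponentSet.top_mem {P : Set ℝ≥0∞} (h : IsExponentSet P) : ∞ ∈ P := by
  rcases h with rfl | ⟨p₀, _, hlt, rfl | rfl⟩
  · exact rfl
  · exact ⟨le_top, le_rfl⟩
  · exact ⟨hlt, le_rfl⟩

/-- Passing to the closure can only add the left endpoint of a half-open interval, so just four
patterns occur. -/
theorem exists_isProfile {Ps Pw : Set ℝ≥0∞} (hPs : IsExponentSet Ps) (hPw : IsExponentSet Pw)
    (h : Ps ⊆ Pw) (h' : Pw ⊆ closure Ps) :
    ∃ (L : ℕ → ℕ) (N : ℕ → ℕ → ℕ), IsProfile L N Ps Pw := by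
  rcases hPs with rfl | ⟨p₀, hp₀, hlt, hPs⟩
  · rw [closure_singleton] at h'
    obtain rfl := h.antisymm h'
    exact ⟨_, _, isProfile_top⟩
  obtain ⟨p, rfl⟩ : ∃ p : ℝ, p₀ = ENNReal.ofReal p := ⟨_, (ENNReal.ofReal_toReal hlt.ne).symm⟩
  have hp : 1 ≤ p := by simpa using hp₀
  rcases hPs with rfl | rfl
  · rw [isClosed_Icc.closure_eq] at h'
    obtain rfl := h.antisymm h'
    exact ⟨_, _, isProfile_Icc_Icc hp⟩
  · rw [closure_Ioc hlt.ne] at h'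
    by_cases hmem : ENNReal.ofReal p ∈ Pw
    · have : Pw = Icc (ENNReal.ofReal p) ∞ := by
        refine h'.antisymm fun x hx => ?_
        rcases hx.1.eq_or_lt with rfl | hlt
        · exact hmem
        · exact h ⟨hlt, hx.2⟩
      subst this
      exact ⟨_, _, isProfile_Ioc_Icc hp⟩
    · have : Pw = Ioc (ENNReal.ofReal p) ∞ := by
        refine Subset.antisymm (fun x hx => ⟨lt_of_le_of_ne (h' hx).1 ?_, (h' hx).2⟩) h
        rintro rfl
        exact hmem hx
      subst this
      exact ⟨_, _, isProfile_Ioc_Ioc hp⟩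

/-! ### Comparison of `decay` with the level sums and tails. -/

/-- Leaves sorted by levels: there are `n j` leaves of level `j` for each `j < l`. -/
abbrev LevelLeaf (l : ℕ) (n : ℕ → ℕ) : Type := Σ j : Fin l, Fin (n j)

theorem sum_levelLeaf {M : Type*} [Semiring M] (l : ℕ) (n : ℕ → ℕ) (φ : ℕ → M) :
    ∑ i : LevelLeaf l n, φ i.1 = ∑ j ∈ Finset.range l, (n j : M) * φ j := by
  rw [Fintype.sum_sigma, ← Fin.sum_univ_eq_sum_range (fun j => (n j : M) * φ j)]
  simp

/-- The integral of `g (2⁻ʲ)` for the measure on levels that underlies `levelSum` and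
`levelTail`. -/
noncomputable def levelIntegral (l : ℕ) (n : ℕ → ℕ) (g : ℝ≥0∞ → ℝ≥0∞) : ℝ≥0∞ :=
  ∑ j ∈ Finset.range l, (n j : ℝ≥0∞) * (2 ^ j * g (((2 ^ j)⁻¹ : ℝ≥0) : ℝ≥0∞))

theorem coe_levelSum (L : ℕ → ℕ) (N : ℕ → ℕ → ℕ) {q : ℝ} (hq : 0 ≤ q) (k : ℕ) :
    (levelSum L N q k : ℝ≥0∞) = levelIntegral (L k) (N k) (fun s => s ^ q) := by
  rw [levelSum, levelIntegral, ENNReal.ofNNReal_finsetSum]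
  refine Finset.sum_congr rfl fun j _ => ?_
  rw [← ENNReal.coe_rpow_of_nonneg _ hq]
  push_cast
  rfl

theorem coe_levelTail (L : ℕ → ℕ) (N : ℕ → ℕ → ℕ) {q : ℝ} (hq : 0 ≤ q) (k : ℕ) (t : ℝ≥0) :
    (levelTail L N q k t : ℝ≥0∞) =
      levelIntegral (L k) (N k) (fun s => (t : ℝ≥0∞) ^ q * indicator (Ioi (t : ℝ≥0∞)) 1 s) := by
  rw [levelTail, levelIntegral, Finset.mul_sum, ENNReal.ofNNReal_finsetSum]
  refine Finset.sum_congr rfl fun j _ => ?_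
  rw [← ENNReal.coe_rpow_of_nonneg _ hq, indicator_apply]
  simp only [mem_Ioi, ENNReal.coe_lt_coe]
  split_ifs
  · simp only [Pi.one_apply]
    push_cast
    ring
  · simp

theorem monotone_indicator_Ioi (t : ℝ≥0∞) (c : ℝ≥0∞) :
    Monotone fun s : ℝ≥0∞ => c * indicator (Ioi t) 1 s := by
  intro s s' h
  dsimp only
  gcongr
  by_cases hs : t < s
  · simp [hs, hs.trans_le h]
  · simp [hs]

namespace StarWeights

open StarPoint

variable {K : Type} {l : K → ℕ} {n : K → ℕ → ℕ}
  (w : StarWeights K fun k => LevelLeaf (l k) (n k)) {A : K → ℕ → ℝ≥0}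

theorem lintegral_comp_decay (ha : ∀ k i, w.a k i = A k i.1) (hb : ∀ k i, w.b k i = 2 ^ (i.1 : ℕ))
    (g : ℝ≥0∞ → ℝ≥0∞) (θ : ℝ≥0∞) (k : K) :
    ∫⁻ x, g (w.decay θ x) ∂w.starMeasure k = g 1 + ∑ j ∈ Finset.range (l k),
      (n k j : ℝ≥0∞) * (A k j * g (1 + (A k j + 2 ^ j) : ℝ≥0∞)⁻¹ +
        2 ^ j * g (θ * (1 + (A k j + 2 ^ j) : ℝ≥0∞)⁻¹)) := by
  rw [lintegral_starMeasure, ← sum_levelLeaf (l k) (n k) fun j =>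
    (A k j * g (1 + (A k j + 2 ^ j) : ℝ≥0∞)⁻¹ + 2 ^ j * g (θ * (1 + (A k j + 2 ^ j) : ℝ≥0∞)⁻¹) : ℝ≥0∞)]
  simp [decay, ha, hb]

/-- A general monotone `g` treats moments and distribution functions at once. Mid and tip each have
mass at most `2 ^ j` and height at most `2⁻ʲ`, whence the factor 2; `g 1` is the hub. -/
theorem lintegral_comp_decay_le (ha : ∀ k i, w.a k i = A k i.1)
    (hb : ∀ k i, w.b k i = 2 ^ (i.1 : ℕ)) (hA : ∀ k j, A k j ≤ 2 ^ j)
    {g : ℝ≥0∞ → ℝ≥0∞} (hg : Monotone g) {θ : ℝ≥0∞} (hθ : θ ≤ 1) (k : K) :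
    ∫⁻ x, g (w.decay θ x) ∂w.starMeasure k ≤ g 1 + 2 * levelIntegral (l k) (n k) g := by
  rw [w.lintegral_comp_decay ha hb, levelIntegral, Finset.mul_sum]
  refine add_le_add_right (Finset.sum_le_sum fun j _ => ?_) _
  have hA' : (A k j : ℝ≥0∞) ≤ 2 ^ j := by exact_mod_cast hA k j
  have h1 : (1 + (A k j + 2 ^ j) : ℝ≥0∞)⁻¹ ≤ (((2 ^ j)⁻¹ : ℝ≥0) : ℝ≥0∞) := by
    rw [ENNReal.coe_inv (by positivity)]
    push_cast
    exact ENNReal.inv_le_inv.2 (le_add_left le_add_self)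
  have h2 : θ * (1 + (A k j + 2 ^ j) : ℝ≥0∞)⁻¹ ≤ (((2 ^ j)⁻¹ : ℝ≥0) : ℝ≥0∞) :=
    (mul_le_of_le_one_left' hθ).trans h1
  calc _ ≤ (n k j : ℝ≥0∞) * (2 ^ j * g (((2 ^ j)⁻¹ : ℝ≥0) : ℝ≥0∞) +
        2 ^ j * g (((2 ^ j)⁻¹ : ℝ≥0) : ℝ≥0∞)) :=
        mul_le_mul_right (add_le_add (mul_le_mul' hA' (hg h1)) (mul_le_mul_right (hg h2) _)) _
    _ = _ := by ring

/-- Some vertex of mass `2 ^ j` must see the hub: the tip if `θ = 1`, the mid if `A k j = 2 ^ j`. -/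
theorem levelIntegral_le (ha : ∀ k i, w.a k i = A k i.1)
    (hb : ∀ k i, w.b k i = 2 ^ (i.1 : ℕ)) (hA : ∀ k j, A k j ≤ 2 ^ j)
    {g : ℝ≥0∞ → ℝ≥0∞} (hg : Monotone g) {θ : ℝ≥0∞} (k : K)
    (hk : θ = 1 ∨ ∀ j, A k j = 2 ^ j) :
    levelIntegral (l k) (n k) g ≤ ∫⁻ x, g (4 * w.decay θ x) ∂w.starMeasure k := by
  rw [w.lintegral_comp_decay ha hb (fun s => g (4 * s)), levelIntegral]
  refine le_add_left (Finset.sum_le_sum fun j _ => mul_le_mul_right ?_ _)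
  have hA' : (A k j : ℝ≥0∞) ≤ 2 ^ j := by exact_mod_cast hA k j
  -- Each of the three masses in a triple is at most `2 ^ j`; 3 is rounded up to 4.
  have h1 : (((2 ^ j)⁻¹ : ℝ≥0) : ℝ≥0∞) ≤ 4 * (1 + (A k j + 2 ^ j) : ℝ≥0∞)⁻¹ := by
    rw [ENNReal.coe_inv (by positivity), ← div_eq_mul_inv, ENNReal.le_div_iff_mul_le
      (.inl (by simp)) (.inl (by simp [ENNReal.add_eq_top])), mul_comm, ← div_eq_mul_inv]
    push_cast
    refine ENNReal.div_le_of_le_mul ?_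
    calc (1 + (A k j + 2 ^ j) : ℝ≥0∞) ≤ 2 ^ j + (2 ^ j + 2 ^ j) := by
          gcongr
          exact one_le_pow₀ one_le_two
      _ ≤ 2 ^ j + (2 ^ j + 2 ^ j) + 2 ^ j := le_self_add
      _ = _ := by ring
  rcases hk with rfl | hk
  · refine le_add_left ?_
    rw [one_mul]
    exact mul_le_mul_right (hg h1) _
  · refine le_add_right ?_
    have h2 : (A k j : ℝ≥0∞) = 2 ^ j := by rw [hk j]; push_cast; rfl
    nth_rw 1 [h2]
    exact mul_le_mul_right (hg h1) _

/-- For `θ = 0` the tips are invisible, and the hub and all mids together have mass at most 2. -/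
theorem lintegral_decay_zero_le (ha : ∀ k i, w.a k i = A k i.1)
    (hb : ∀ k i, w.b k i = 2 ^ (i.1 : ℕ)) {q : ℝ} (hq : 0 < q) (k : K)
    (hk : ∑ j ∈ Finset.range (l k), (n k j : ℝ≥0) * A k j ≤ 1) :
    ∫⁻ x, w.decay 0 x ^ q ∂w.starMeasure k ≤ 2 := by
  rw [w.lintegral_comp_decay ha hb (fun s => s ^ q)]
  have hk' : ∑ j ∈ Finset.range (l k), (n k j : ℝ≥0∞) * A k j ≤ 1 := by exact_mod_cast hk
  calc _ ≤ 1 + ∑ j ∈ Finset.range (l k), (n k j : ℝ≥0∞) * A k j := by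
        simp only [zero_mul, ENNReal.zero_rpow_of_pos hq, mul_zero, add_zero, ENNReal.one_rpow]
        gcongr with j _
        refine mul_le_of_le_one_right' (ENNReal.rpow_le_one ?_ hq.le)
        exact ENNReal.inv_le_one.2 le_self_add
    _ ≤ 1 + 1 := by gcongr
    _ = 2 := one_add_one_eq_two

theorem rpow_mul_starMeasure_eq {J : K → Type} [∀ k, Fintype (J k)] (w : StarWeights K J)
    (q : ℝ) (θ : ℝ≥0∞) (k : K) (t : ℝ≥0∞) :
    t ^ q * w.starMeasure k {x | t < w.decay θ x} =
      ∫⁻ x, t ^ q * indicator (Ioi t) 1 (w.decay θ x) ∂w.starMeasure k := by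
  rw [lintegral_const_mul _ .of_discrete, ← lintegral_indicator_one .of_discrete]
  rfl

theorem rpow_mul_starMeasure_le {J : K → Type} [∀ k, Fintype (J k)] (w : StarWeights K J)
    {q : ℝ} (hq : 0 ≤ q) (θ : ℝ≥0∞) (k : K) (t : ℝ≥0∞) :
    t ^ q * w.starMeasure k {x | t < w.decay θ x} ≤ ∫⁻ x, w.decay θ x ^ q ∂w.starMeasure k := by
  refine le_trans (mul_le_mul_right (measure_mono fun x hx => ?_) _)
    (mul_meas_ge_le_lintegral (f := fun x => w.decay θ x ^ q) .of_discrete (t ^ q))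
  exact ENNReal.rpow_le_rpow (le_of_lt hx) hq

end StarWeights

/-! ### Assembling the two families of stars. -/

theorem exists_forall_bool_prod_iff {ι : Type*} {P : Bool × ι → ℝ≥0 → Prop}
    (hP : ∀ k C D, C ≤ D → P k C → P k D) :
    (∃ C, ∀ k, P k C) ↔ (∃ C, ∀ i, P (true, i) C) ∧ ∃ C, ∀ i, P (false, i) C := by
  constructor
  · rintro ⟨C, hC⟩
    exact ⟨⟨C, fun i => hC (true, i)⟩, ⟨C, fun i => hC (false, i)⟩⟩
  · rintro ⟨⟨C, hC⟩, D, hD⟩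
    refine ⟨max C D, ?_⟩
    rintro ⟨_ | _, i⟩
    · exact hP _ _ _ (le_max_right C D) (hD i)
    · exact hP _ _ _ (le_max_left C D) (hC i)

/-- The relative mass of the inner vertices of level `j`: it equals `2 ^ j` in the stars
`(true, k)`, and the inner vertices of a star `(false, k)` have total mass at most one. -/
noncomputable def innerMass (L : Bool → ℕ → ℕ) (N : Bool → ℕ → ℕ → ℕ) (k : Bool × ℕ) (j : ℕ) :
    ℝ≥0 :=
  if k.1 then 2 ^ j else (1 + ∑ j ∈ Finset.range (L k.1 k.2), (N k.1 k.2 j : ℝ≥0))⁻¹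

theorem innerMass_pos (L : Bool → ℕ → ℕ) (N : Bool → ℕ → ℕ → ℕ) (k : Bool × ℕ) (j : ℕ) :
    0 < innerMass L N k j := by
  unfold innerMass
  split_ifs <;> positivity

theorem innerMass_le (L : Bool → ℕ → ℕ) (N : Bool → ℕ → ℕ → ℕ) (k : Bool × ℕ) (j : ℕ) :
    innerMass L N k j ≤ 2 ^ j := by
  unfold innerMass
  split_ifs
  · exact le_rfl
  · exact (inv_le_one_of_one_le₀ le_self_add).trans (one_le_pow₀ one_le_two)

theorem sum_innerMass_le (L : Bool → ℕ → ℕ) (N : Bool → ℕ → ℕ → ℕ) (k : ℕ) :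
    ∑ j ∈ Finset.range (L false k), (N false k j : ℝ≥0) * innerMass L N (false, k) j ≤ 1 := by
  simp only [innerMass, Bool.false_eq_true, if_false]
  rw [← Finset.sum_mul, ← div_eq_mul_inv]
  exact div_le_one_of_le₀ le_add_self zero_le

theorem exists_starWeights (L : Bool → ℕ → ℕ) (N : Bool → ℕ → ℕ → ℕ) :
    ∃ w : StarWeights (Bool × ℕ) (fun k => LevelLeaf (L k.1 k.2) (N k.1 k.2)),
      (∀ k i, w.a k i = innerMass L N k i.1) ∧ ∀ k i, w.b k i = 2 ^ (i.1 : ℕ) := by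
  -- The boundedness criteria do not involve `W`, so the hub masses may be as small as finiteness of
  -- the total mass requires.
  obtain ⟨W, hW, hsum⟩ := ENNReal.exists_pos_tsum_mul_lt_of_countable one_ne_zero
    (fun k : Bool × ℕ => (1 + ∑ i : LevelLeaf (L k.1 k.2) (N k.1 k.2),
      ((innerMass L N k i.1 : ℝ≥0∞) + ((2 ^ (i.1 : ℕ) : ℝ≥0) : ℝ≥0∞)))) (fun k => by
        simp [ENNReal.add_eq_top, ENNReal.sum_eq_top])
  exact ⟨
    { W := W
      a := fun k i => innerMass L N k i.1
      b := fun _ i => 2 ^ (i.1 : ℕ)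
      W_pos := hW
      a_pos := fun k i => innerMass_pos L N k _
      b_pos := fun k i => by positivity
      one_le := fun k i => le_add_left (one_le_pow₀ one_le_two)
      summable := by
        simp only [mul_comm] at hsum ⊢
        exact (hsum.trans ENNReal.one_lt_top).ne }, fun _ _ => rfl, fun _ _ => rfl⟩

section Exponents

open StarWeights

variable {L : Bool → ℕ → ℕ} {N : Bool → ℕ → ℕ → ℕ}
  {w : StarWeights (Bool × ℕ) (fun k => LevelLeaf (L k.1 k.2) (N k.1 k.2))}
  (ha : ∀ k i, w.a k i = innerMass L N k i.1) (hb : ∀ k i, w.b k i = 2 ^ (i.1 : ℕ))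

include ha hb

theorem exists_lintegral_decay_le_iff {q : ℝ} (hq : 0 < q) {θ : ℝ≥0∞} (hθ : θ ≤ 1) {β : Bool}
    (hβ : θ = 1 ∨ β = true) :
    (∃ C : ℝ≥0, ∀ k, ∫⁻ x, w.decay θ x ^ q ∂w.starMeasure (β, k) ≤ C) ↔
      ∃ C : ℝ≥0, ∀ k, levelSum (L β) (N β) q k ≤ C := by
  have hg : Monotone fun s : ℝ≥0∞ => s ^ q := ENNReal.monotone_rpow_of_nonneg hq.le
  constructor
  · rintro ⟨C, hC⟩
    refine ⟨4 ^ q * C, fun k => ?_⟩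
    rw [← ENNReal.coe_le_coe, coe_levelSum _ _ hq.le]
    refine (w.levelIntegral_le ha hb (innerMass_le L N) hg (β, k)
      (hβ.imp_right fun h j => by simp [innerMass, h])).trans ?_
    simp only [ENNReal.mul_rpow_of_nonneg _ _ hq.le]
    rw [lintegral_const_mul _ .of_discrete, ENNReal.coe_mul, ENNReal.coe_rpow_of_nonneg _ hq.le]
    exact mul_le_mul_right (hC k) _
  · rintro ⟨C, hC⟩
    refine ⟨1 + 2 * C, fun k => ?_⟩
    refine (w.lintegral_comp_decay_le ha hb (innerMass_le L N) hg hθ (β, k)).trans ?_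
    rw [ENNReal.one_rpow, ← coe_levelSum (L β) (N β) hq.le]
    exact_mod_cast add_le_add_right (mul_le_mul_right (hC k) _) _

theorem exists_starMeasure_decay_le_iff {q : ℝ} (hq : 0 < q) {θ : ℝ≥0∞} (hθ : θ ≤ 1) {β : Bool}
    (hβ : θ = 1 ∨ β = true) :
    (∃ C : ℝ≥0, ∀ k, ∀ t : ℝ≥0, 0 < t →
      (t : ℝ≥0∞) ^ q * w.starMeasure (β, k) {x | (t : ℝ≥0∞) < w.decay θ x} ≤ C) ↔
      ∃ C : ℝ≥0, ∀ k, ∀ t : ℝ≥0, 0 < t → levelTail (L β) (N β) q k t ≤ C := by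
  constructor
  · rintro ⟨C, hC⟩
    refine ⟨4 ^ q * C, fun k t ht => ?_⟩
    -- The factor 4 lost in `levelIntegral_le` is absorbed by rescaling the height.
    obtain ⟨s, rfl⟩ : ∃ s, t = 4 * s := ⟨t / 4, by rw [mul_div_cancel₀ _ four_ne_zero]⟩
    rw [← ENNReal.coe_le_coe, coe_levelTail _ _ hq.le]
    refine (w.levelIntegral_le ha hb (innerMass_le L N) (monotone_indicator_Ioi _ _) (β, k)
      (hβ.imp_right fun h j => by simp [innerMass, h])).trans ?_
    have h1 : ∀ y : ℝ≥0∞, indicator (Ioi ((4 * s : ℝ≥0) : ℝ≥0∞)) (1 : ℝ≥0∞ → ℝ≥0∞) (4 * y) =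
        indicator (Ioi (s : ℝ≥0∞)) 1 y := fun y => by
      have : (4 : ℝ≥0∞) * s < 4 * y ↔ (s : ℝ≥0∞) < y :=
        ENNReal.mul_lt_mul_iff_right four_ne_zero (by simp)
      simp only [indicator_apply, mem_Ioi, ENNReal.coe_mul, ENNReal.coe_ofNat, this, Pi.one_apply]
    simp only [h1]
    simp only [ENNReal.coe_mul, ENNReal.mul_rpow_of_nonneg _ _ hq.le, mul_assoc,
      ENNReal.coe_rpow_of_nonneg _ hq.le]
    rw [lintegral_const_mul _ .of_discrete, ← rpow_mul_starMeasure_eq]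
    exact mul_le_mul_right (hC k s (by simpa using ht)) _
  · rintro ⟨C, hC⟩
    refine ⟨1 + 2 * C, fun k t ht => ?_⟩
    rw [rpow_mul_starMeasure_eq]
    refine (w.lintegral_comp_decay_le ha hb (innerMass_le L N)
      (monotone_indicator_Ioi (t : ℝ≥0∞) ((t : ℝ≥0∞) ^ q)) hθ (β, k)).trans ?_
    rw [← coe_levelTail (L β) (N β) hq.le]
    push_cast
    refine add_le_add ?_ (mul_le_mul_right (by exact_mod_cast hC k t ht) _)
    by_cases h : (t : ℝ≥0∞) < 1
    · simpa [h] using ENNReal.rpow_le_one h.le hq.le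
    · simp [h]

end Exponents

section Split

variable {J : Bool × ℕ → Type} [∀ k, Fintype (J k)] {w : StarWeights (Bool × ℕ) J}
  {T : (StarPoint (Bool × ℕ) J → ℝ) → StarPoint (Bool × ℕ) J → ℝ≥0∞} {θ : ℝ≥0∞} {p : ℝ≥0∞}

theorem StarWeights.IsControlled.hasStrongType_iff_and (hT : w.IsControlled T θ) (hp : 1 ≤ p)
    (hp' : p ≠ ∞) :
    HasStrongType T p w.measure ↔
      (∃ C : ℝ≥0, ∀ k, ∫⁻ x, w.decay θ x ^ p.toReal ∂w.starMeasure (true, k) ≤ C) ∧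
      ∃ C : ℝ≥0, ∀ k, ∫⁻ x, w.decay θ x ^ p.toReal ∂w.starMeasure (false, k) ≤ C := by
  rw [hT.hasStrongType_iff hp hp']
  exact exists_forall_bool_prod_iff (P := fun k C =>
    ∫⁻ x, w.decay θ x ^ p.toReal ∂w.starMeasure k ≤ C)
    fun _ _ _ hCD h => h.trans (by exact_mod_cast hCD)

theorem StarWeights.IsControlled.hasWeakType_iff_and (hT : w.IsControlled T θ) (hp : 1 ≤ p)
    (hp' : p ≠ ∞) :
    HasWeakType T p w.measure ↔
      (∃ C : ℝ≥0, ∀ k, ∀ t : ℝ≥0, 0 < t → (t : ℝ≥0∞) ^ p.toReal *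
        w.starMeasure (true, k) {x | (t : ℝ≥0∞) < w.decay θ x} ≤ C) ∧
      ∃ C : ℝ≥0, ∀ k, ∀ t : ℝ≥0, 0 < t → (t : ℝ≥0∞) ^ p.toReal *
        w.starMeasure (false, k) {x | (t : ℝ≥0∞) < w.decay θ x} ≤ C := by
  rw [hT.hasWeakType_iff hp hp']
  exact exists_forall_bool_prod_iff (P := fun k C => ∀ t : ℝ≥0, 0 < t →
    (t : ℝ≥0∞) ^ p.toReal * w.starMeasure k {x | (t : ℝ≥0∞) < w.decay θ x} ≤ C)
    fun _ _ _ hCD h t ht => (h t ht).trans (by exact_mod_cast hCD)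

end Split

section Types

open StarWeights

variable {L : Bool → ℕ → ℕ} {N : Bool → ℕ → ℕ → ℕ}
  {w : StarWeights (Bool × ℕ) (fun k => LevelLeaf (L k.1 k.2) (N k.1 k.2))}
  (ha : ∀ k i, w.a k i = innerMass L N k i.1) (hb : ∀ k i, w.b k i = 2 ^ (i.1 : ℕ))
  {Psc Ps Pwc Pw : Set ℝ≥0∞} (hc : IsProfile (L true) (N true) Psc Pwc)
  (hn : IsProfile (L false) (N false) Ps Pw) {p : ℝ≥0∞} (hp : 1 ≤ p) (hp' : p ≠ ∞)

include ha hb hc hp hp'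

theorem hasStrongType_centeredMaximal_iff :
    HasStrongType (centeredMaximal w.measure) p w.measure ↔ p ∈ Psc := by
  have hq : 1 ≤ p.toReal := by simpa using ENNReal.toReal_mono hp' hp
  have hq0 : 0 < p.toReal := by linarith
  have key := hc.strong p.toReal hq
  rw [ENNReal.ofReal_toReal hp'] at key
  rw [w.isControlled_centeredMaximal.hasStrongType_iff_and hp hp',
    exists_lintegral_decay_le_iff ha hb hq0 zero_le_one (.inr rfl), ← key]
  -- The stars `(false, k)` impose no condition on the centered operator.
  exact and_iff_left ⟨2, fun k => w.lintegral_decay_zero_le ha hb hq0 _ (sum_innerMass_le L N k)⟩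

theorem hasWeakType_centeredMaximal_iff :
    HasWeakType (centeredMaximal w.measure) p w.measure ↔ p ∈ Pwc := by
  have hq : 1 ≤ p.toReal := by simpa using ENNReal.toReal_mono hp' hp
  have hq0 : 0 < p.toReal := by linarith
  have key := hc.weak p.toReal hq
  rw [ENNReal.ofReal_toReal hp'] at key
  rw [w.isControlled_centeredMaximal.hasWeakType_iff_and hp hp',
    exists_starMeasure_decay_le_iff ha hb hq0 zero_le_one (.inr rfl), ← key]
  exact and_iff_left ⟨2, fun k t _ => (w.rpow_mul_starMeasure_le hq0.le 0 _ t).trans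
    (w.lintegral_decay_zero_le ha hb hq0 _ (sum_innerMass_le L N k))⟩

include hn

theorem hasStrongType_noncenteredMaximal_iff :
    HasStrongType (noncenteredMaximal w.measure) p w.measure ↔ p ∈ Psc ∧ p ∈ Ps := by
  have hq : 1 ≤ p.toReal := by simpa using ENNReal.toReal_mono hp' hp
  have hq0 : 0 < p.toReal := by linarith
  have key := hc.strong p.toReal hq
  have key' := hn.strong p.toReal hq
  rw [ENNReal.ofReal_toReal hp'] at key key'
  rw [w.isControlled_noncenteredMaximal.hasStrongType_iff_and hp hp',
    exists_lintegral_decay_le_iff ha hb hq0 le_rfl (.inl rfl),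
    exists_lintegral_decay_le_iff ha hb hq0 le_rfl (.inl rfl), key, key']

theorem hasWeakType_noncenteredMaximal_iff :
    HasWeakType (noncenteredMaximal w.measure) p w.measure ↔ p ∈ Pwc ∧ p ∈ Pw := by
  have hq : 1 ≤ p.toReal := by simpa using ENNReal.toReal_mono hp' hp
  have hq0 : 0 < p.toReal := by linarith
  have key := hc.weak p.toReal hq
  have key' := hn.weak p.toReal hq
  rw [ENNReal.ofReal_toReal hp'] at key key'
  rw [w.isControlled_noncenteredMaximal.hasWeakType_iff_and hp hp',
    exists_starMeasure_decay_le_iff ha hb hq0 le_rfl (.inl rfl),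
    exists_starMeasure_decay_le_iff ha hb hq0 le_rfl (.inl rfl), key, key']

end Types

/-! ### The main theorem. -/

theorem theorem1 (Psc Ps Pwc Pw : Set ℝ≥0∞)
    (hPsc : IsExponentSet Psc) (hPs : IsExponentSet Ps)
    (hPwc : IsExponentSet Pwc) (hPw : IsExponentSet Pw)
    (h₁ : Ps ⊆ Psc) (h₂ : Pw ⊆ Pwc)
    (h₃ : Psc ⊆ Pwc) (h₄ : Pwc ⊆ closure Psc)
    (h₅ : Ps ⊆ Pw) (h₆ : Pw ⊆ closure Ps) :
    ∃ (X : Type) (_ : MetricSpace X) (_ : MeasurableSpace X) (_ : BorelSpace X) (μ : Measure X),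
      BallsPosFinite μ ∧ ¬ IsDoublingMeasure μ ∧
      ∀ p : ℝ≥0∞, 1 ≤ p →
        (HasStrongType (centeredMaximal μ) p μ ↔ p ∈ Psc) ∧
        (HasStrongType (noncenteredMaximal μ) p μ ↔ p ∈ Ps) ∧
        (HasWeakType (centeredMaximal μ) p μ ↔ p ∈ Pwc) ∧
        (HasWeakType (noncenteredMaximal μ) p μ ↔ p ∈ Pw) := by
  obtain ⟨Lc, Nc, hc⟩ := exists_isProfile hPsc hPwc h₃ h₄
  obtain ⟨Ln, Nn, hn⟩ := exists_isProfile hPs hPw h₅ h₆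
  obtain ⟨L, rfl, rfl⟩ : ∃ L : Bool → ℕ → ℕ, L true = Lc ∧ L false = Ln :=
    ⟨fun β => bif β then Lc else Ln, rfl, rfl⟩
  obtain ⟨N, rfl, rfl⟩ : ∃ N : Bool → ℕ → ℕ → ℕ, N true = Nc ∧ N false = Nn :=
    ⟨fun β => bif β then Nc else Nn, rfl, rfl⟩
  obtain ⟨w, ha, hb⟩ := exists_starWeights L N
  refine ⟨StarPoint (Bool × ℕ) fun k => LevelLeaf (L k.1 k.2) (N k.1 k.2), inferInstance,
    inferInstance, inferInstance, w.measure, w.ballsPosFinite, w.not_isDoublingMeasure,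
    fun p hp => ?_⟩
  rcases eq_or_ne p ∞ with rfl | hp'
  · have h : HasStrongType (noncenteredMaximal w.measure) ∞ w.measure :=
      hasStrongType_top (noncenteredMaximal_le_eLpNorm_top w.measure)
    have hcen : HasStrongType (centeredMaximal w.measure) ∞ w.measure :=
      hasStrongType_top fun f x => (centeredMaximal_le_noncenteredMaximal _ f x).trans
        (noncenteredMaximal_le_eLpNorm_top w.measure f x)
    exact ⟨iff_of_true hcen hPsc.top_mem, iff_of_true h hPs.top_mem,
      iff_of_true (hasWeakType_top_iff.2 hcen) hPwc.top_mem,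
      iff_of_true (hasWeakType_top_iff.2 h) hPw.top_mem⟩
  · exact ⟨hasStrongType_centeredMaximal_iff ha hb hc hp hp',
      -- The first family also constrains the non-centered operator; the inclusion of `Ps` in `Psc`
      -- makes this redundant, and likewise for the weak types.
      (hasStrongType_noncenteredMaximal_iff ha hb hc hn hp hp').trans
        (and_iff_right_of_imp fun h => h₁ h),
      hasWeakType_centeredMaximal_iff ha hb hc hp hp',
      (hasWeakType_noncenteredMaximal_iff ha hb hc hn hp hp').trans
        (and_iff_right_of_imp fun h => h₂ h)⟩
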